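/- Let $\mathbb K$ be a field of characteristic $0$, $\Gamma$ an abelian group (written additively), and $\varepsilon:\Gamma\times\Gamma\to\mathbb K^\ast$ a commutation factor, i.e. $\varepsilon(i,j)\varepsilon(j,i)=1$, $\varepsilon(i,j+k)=\varepsilon(i,j)\varepsilon(i,k)$ and $\varepsilon(i+j,k)=\varepsilon(i,k)\varepsilon(j,k)$ for all $i,j,k\in\Gamma$. Let $A=\bigoplus_{i\in\Gamma}A^i$ be an associative unital $\Gamma$-graded $\mathbb K$-algebra; the degree of a homogeneous element $x$ is denoted by $|x|$. The $\varepsilon$-center $Z_\varepsilon(A)$ is the graded subspace of $A$ whose homogeneous elements are the homogeneous $z\in A$ with $zb=\varepsilon(|z|,|b|)\,bz$ for all homogeneous $b\in A$. For any $\Gamma$-graded algebra, an $\varepsilon$-derivation of degree $i$ is a linear map $X$ of the algebra to itself, homogeneous of degree $i$, with $X(ab)=X(a)b+\varepsilon(i,|a|)\,aX(b)$ for all $a,b$ with $a$ homogeneous; $\mathrm{Der}_\varepsilon(A)$ is the direct sum over $i\in\Gamma$ of the spaces of $\varepsilon$-derivations of $A$ of degree $i$. For homogeneous $X,Y\in\mathrm{Der}_\varepsilon(A)$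 and $z\in Z_\varepsilon(A)$, let $[X,Y]_\varepsilon=XY-\varepsilon(|X|,|Y|)\,YX$ and $(Xz)(a)=\varepsilon(|X|,|z|)\,zX(a)$; both belong to $\mathrm{Der}_\varepsilon(A)$. For a $\Gamma$-graded right $A$-module $M=\bigoplus_{i\in\Gamma}M^i$ (with $M^iA^j\subset M^{i+j}$), $n\in\mathbb N$ and $k\in\Gamma$, let $\Omega_\varepsilon^{n,k}(A,M)$ be the space of $\mathbb K$-multilinear maps $\omega:\mathrm{Der}_\varepsilon(A)^n\to M$ such that, for all homogeneous $X_1,\dots,X_n\in\mathrm{Der}_\varepsilon(A)$ and $z\in Z_\varepsilon(A)$, $$\omega(X_1,\dots,X_n)\in M^{k+|X_1|+\dots+|X_n|},\qquad \omega(X_1,\dots,X_nz)=\omega(X_1,\dots,X_n)z,$$ $$\omega(X_1,\dots,X_i,X_{i+1},\dots,X_n)=-\varepsilon(|X_i|,|X_{i+1}|)\,\omega(X_1,\dots,X_{i+1},X_i,\dots,X_n)\qquad(1\le i<n),$$ with $\Omega_\varepsilon^{0,k}(A,M)=M^k$. Let $\Omega_\varepsilon(A,M)=\bigoplus_{n,k}\Omega_\varepsilon^{n,k}(A,M)$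 and $\Omega_\varepsilon(A)=\Omega_\varepsilon(A,A)$; both are regarded as $(\mathbb Z\times\Gamma)$-graded, with zero components in negative $\mathbb Z$-degree. For $\omega\in\Omega_\varepsilon^{p,|\omega|}$ write $|\omega|\in\Gamma$ for its $\Gamma$-degree. Then the following hold. 1. There are a unique bilinear product on $\Omega_\varepsilon(A)$, with $\Omega_\varepsilon^{p,k}(A)\cdot\Omega_\varepsilon^{q,l}(A)\subset\Omega_\varepsilon^{p+q,k+l}(A)$, and a unique linear map $d:\Omega_\varepsilon(A)\to\Omega_\varepsilon(A)$, with $d\,\Omega_\varepsilon^{p,k}(A)\subset\Omega_\varepsilon^{p+1,k}(A)$, such that for all $\omega\in\Omega_\varepsilon^{p,|\omega|}(A)$, $\eta\in\Omega_\varepsilon^{q,|\eta|}(A)$ and homogeneous $X_1,X_2,\ldots\in\mathrm{Der}_\varepsilon(A)$, $$(\omega\cdot\eta)(X_1,\dots,X_{p+q})=\frac1{p!\,q!}\sum_{\sigma\in S_{p+q}}\mathrm{sgn}(\sigma)\,f_1\;\omega(X_{\sigma(1)},\dots,X_{\sigma(p)})\,\eta(X_{\sigma(p+1)},\dots,X_{\sigma(p+q)}),$$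 $$d\omega(X_1,\dots,X_{p+1})=\sum_{m=1}^{p+1}(-1)^{m+1}f_2\;X_m\big(\omega(X_1,\dots\widehat{X_m}\dots,X_{p+1})\big)+\sum_{1\le m<n\le p+1}(-1)^{m+n}f_3\;\omega([X_m,X_n]_\varepsilon,X_1,\dots\widehat{X_m}\dots\widehat{X_n}\dots,X_{p+1}),$$ where $$f_1=\prod_{m<n,\ \sigma(m)>\sigma(n)}\varepsilon(|X_{\sigma(n)}|,|X_{\sigma(m)}|)\prod_{m\le p}\varepsilon(|\eta|,|X_{\sigma(m)}|),\qquad f_2=\varepsilon(|\omega|,|X_m|)\prod_{a=1}^{m-1}\varepsilon(|X_a|,|X_m|),$$ $$f_3=\varepsilon(|X_n|,|X_m|)\prod_{a=1}^{m-1}\varepsilon(|X_a|,|X_m|)\prod_{a=1}^{n-1}\varepsilon(|X_a|,|X_n|).$$ 2. With this product, $\Omega_\varepsilon(A)$ is an associative unital $(\mathbb Z\times\Gamma)$-graded algebra, whose unit is the $0$-form $1\in A^0$; $\widetilde\varepsilon((p,i),(q,j))=(-1)^{pq}\varepsilon(i,j)$ is a commutation factor on $\mathbb Z\times\Gamma$;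 and $d$ is an $\widetilde\varepsilon$-derivation of $\Omega_\varepsilon(A)$ of degree $(1,0)$ with $d^2=0$. 3. For every $\Gamma$-graded right $A$-module $M$, there is a unique bilinear action $\Omega_\varepsilon(A,M)\times\Omega_\varepsilon(A)\to\Omega_\varepsilon(A,M)$, with $\Omega_\varepsilon^{p,k}(A,M)\,\Omega_\varepsilon^{q,l}(A)\subset\Omega_\varepsilon^{p+q,k+l}(A,M)$, given for $\omega\in\Omega_\varepsilon^{p,|\omega|}(A,M)$ and $\eta\in\Omega_\varepsilon^{q,|\eta|}(A)$ by the same formula as the product above, and it makes $\Omega_\varepsilon(A,M)$ a $(\mathbb Z\times\Gamma)$-graded right module over the algebra $\Omega_\varepsilon(A)$. -/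

import Mathlib

open scoped DirectSum RightActions

universe u₁ u₂ u₃ u₄

/-- A commutation factor on the abelian group `Γ` over the field `K`. -/
structure CommutationFactor (K Γ : Type*) [Field K] [AddCommGroup Γ] where
  toFun : Γ → Γ → Kˣ
  mul_swap : ∀ i j, toFun i j * toFun j i = 1
  map_add_right : ∀ i j k, toFun i (j + k) = toFun i j * toFun i k
  map_add_left : ∀ i j k, toFun (i + j) k = toFun i k * toFun j k

instance {K Γ : Type*} [Field K] [AddCommGroup Γ] :
    CoeFun (CommutationFactor K Γ) (fun _ => Γ → Γ → Kˣ) := ⟨CommutationFactor.toFun⟩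

/-- The commutation factor `((p, i), (q, j)) ↦ (-1) ^ (p q) ε(i, j)` on `ℤ × Γ`. -/
def CommutationFactor.tilde {K Γ : Type*} [Field K] [AddCommGroup Γ]
    (ε : CommutationFactor K Γ) : CommutationFactor K (ℤ × Γ) where
  toFun x y := (-1) ^ (x.1 * y.1) * ε x.2 y.2
  mul_swap x y := by
    rw [mul_mul_mul_comm, ε.mul_swap, mul_comm y.1 x.1, ← mul_zpow]
    simp
  map_add_right x y z := by
    rw [Prod.fst_add, Prod.snd_add, mul_add, zpow_add, ε.map_add_right, mul_mul_mul_comm]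
  map_add_left x y z := by
    rw [Prod.fst_add, Prod.snd_add, add_mul, zpow_add, ε.map_add_left, mul_mul_mul_comm]

/-- `EpsDerivations ε 𝒱 mul i`: the homogeneous linear maps of degree `i` on the graded space
`(V, 𝒱)` which are `ε`-derivations for the bilinear product `mul`. -/
def EpsDerivations {K Γ V : Type*} [Field K] [AddCommGroup Γ] [AddCommMonoid V] [Module K V]
    (ε : CommutationFactor K Γ) (𝒱 : Γ → Submodule K V) (mul : V →ₗ[K] V →ₗ[K] V) (i : Γ) :
    Submodule K (V →ₗ[K] V) where
  carrier := {X | (∀ j, ∀ a ∈ 𝒱 j, X a ∈ 𝒱 (i + j)) ∧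
    ∀ j, ∀ a ∈ 𝒱 j, ∀ b, X (mul a b) = mul (X a) b + (ε i j : K) • mul a (X b)}
  zero_mem' := by
    refine ⟨fun j a _ => ?_, fun j a _ b => ?_⟩ <;> simp
  add_mem' := by
    rintro X Y ⟨hX, hX'⟩ ⟨hY, hY'⟩
    refine ⟨fun j a ha => add_mem (hX j a ha) (hY j a ha), fun j a ha b => ?_⟩
    simp only [LinearMap.add_apply, hX' j a ha b, hY' j a ha b, map_add, smul_add]
    abel
  smul_mem' := by
    rintro c X ⟨hX, hX'⟩
    refine ⟨fun j a ha => Submodule.smul_mem _ c (hX j a ha), fun j a ha b => ?_⟩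
    simp only [LinearMap.smul_apply, hX' j a ha b, map_smul, smul_add]
    rw [smul_comm c]

/-- A `Γ`-graded associative unital algebra, presented by its product and its unit. -/
structure IsGradedAlgebraProduct {K Γ V : Type*} [Field K] [AddCommGroup Γ] [DecidableEq Γ]
    [AddCommMonoid V] [Module K V]
    (𝒱 : Γ → Submodule K V) (mul : V →ₗ[K] V →ₗ[K] V) (one : V) : Prop where
  isInternal : DirectSum.IsInternal 𝒱
  mul_assoc : ∀ a b c, mul (mul a b) c = mul a (mul b c)
  one_mul : ∀ a, mul one a = a
  mul_one : ∀ a, mul a one = a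
  one_mem : one ∈ 𝒱 0
  mul_mem : ∀ i j, ∀ a ∈ 𝒱 i, ∀ b ∈ 𝒱 j, mul a b ∈ 𝒱 (i + j)

/-- A graded right module over the algebra `(V, mul, one)`, presented by its action. -/
structure IsGradedRightModuleAction {K Γ V W : Type*} [Field K] [AddCommGroup Γ] [DecidableEq Γ]
    [AddCommMonoid V] [Module K V] [AddCommMonoid W] [Module K W]
    (𝒱 : Γ → Submodule K V) (mul : V →ₗ[K] V →ₗ[K] V) (one : V)
    (𝒲 : Γ → Submodule K W) (act : W →ₗ[K] V →ₗ[K] W) : Prop where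
  isInternal : DirectSum.IsInternal 𝒲
  act_act : ∀ w a b, act (act w a) b = act w (mul a b)
  act_one : ∀ w, act w one = w
  act_mem : ∀ i j, ∀ w ∈ 𝒲 i, ∀ a ∈ 𝒱 j, act w a ∈ 𝒲 (i + j)

section Forms

variable {K Γ A M : Type*} [Field K] [AddCommGroup Γ] [Ring A] [Algebra K A]

/-- The homogeneous component of degree `i` of the `ε`-center of `A`. -/
def epsCenter (ε : CommutationFactor K Γ) (𝒜 : Γ → Submodule K A) (i : Γ) : Submodule K A where
  carrier := {z | z ∈ 𝒜 i ∧ ∀ j, ∀ b ∈ 𝒜 j, z * b - (ε i j : K) • (b * z) = 0}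
  zero_mem' := ⟨zero_mem _, by simp⟩
  add_mem' := by
    rintro x y ⟨hx, hx'⟩ ⟨hy, hy'⟩
    refine ⟨add_mem hx hy, fun j b hb => ?_⟩
    have := congrArg₂ (· + ·) (hx' j b hb) (hy' j b hb)
    simp only [add_zero] at this
    rw [← this, add_mul, mul_add, smul_add]
    abel
  smul_mem' := by
    rintro c x ⟨hx, hx'⟩
    refine ⟨Submodule.smul_mem _ c hx, fun j b hb => ?_⟩
    have := congrArg (c • ·) (hx' j b hb)
    simp only [smul_zero] at this
    rw [← this, smul_sub, smul_mul_assoc, mul_smul_comm, smul_comm c]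

/-- The homogeneous `ε`-derivations of degree `i` of the graded algebra `A`. -/
abbrev DerHom (ε : CommutationFactor K Γ) (𝒜 : Γ → Submodule K A) (i : Γ) :
    Submodule K (A →ₗ[K] A) :=
  EpsDerivations ε 𝒜 (LinearMap.mul K A) i

/-- The space of `ε`-derivations of `A`: the (direct) sum of its homogeneous components. -/
def Der (ε : CommutationFactor K Γ) (𝒜 : Γ → Submodule K A) : Submodule K (A →ₗ[K] A) :=
  ⨆ i, DerHom ε 𝒜 i

/-- A homogeneous `ε`-derivation as an element of `Der ε 𝒜`. -/
def toDer {ε : CommutationFactor K Γ} {𝒜 : Γ → Submodule K A} {i : Γ}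
    (X : DerHom ε 𝒜 i) : Der ε 𝒜 :=
  ⟨X.1, Submodule.mem_iSup_of_mem i X.2⟩

/-- The bracket `[X, Y]_ε = X Y - ε(|X|, |Y|) Y X` of homogeneous `ε`-derivations. -/
def derBracket {ε : CommutationFactor K Γ} {𝒜 : Γ → Submodule K A} {i j : Γ}
    (X : DerHom ε 𝒜 i) (Y : DerHom ε 𝒜 j) : DerHom ε 𝒜 (i + j) :=
  ⟨X.1 ∘ₗ Y.1 - (ε i j : K) • (Y.1 ∘ₗ X.1), by
    obtain ⟨X, hX, hX'⟩ := X
    obtain ⟨Y, hY, hY'⟩ := Y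
    simp only [LinearMap.mul_apply'] at hX' hY'
    constructor
    · intro k a ha
      refine sub_mem ?_ (Submodule.smul_mem _ _ ?_)
      · rw [add_assoc]
        exact hX _ _ (hY _ _ ha)
      · rw [add_comm i j, add_assoc]
        exact hY _ _ (hX _ _ ha)
    · intro k a ha b
      have e1 : (ε i (j + k) : K) = ε i j * ε i k := by
        rw [ε.map_add_right, Units.val_mul]
      have e2 : (ε j (i + k) : K) = ε j i * ε j k := by
        rw [ε.map_add_right, Units.val_mul]
      have e3 : (ε (i + j) k : K) = ε i k * ε j k := by
        rw [ε.map_add_left, Units.val_mul]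
      have e4 : (ε i j : K) * ε j i = 1 := by
        rw [← Units.val_mul, ε.mul_swap, Units.val_one]
      simp only [LinearMap.mul_apply', LinearMap.sub_apply, LinearMap.smul_apply,
        LinearMap.comp_apply, hX' k a ha, hY' k a ha, map_add, map_smul,
        hX' _ _ (hY k a ha), hY' _ _ (hX k a ha), e1, e2, e3, sub_mul, mul_sub, smul_add,
        smul_sub, smul_smul, smul_mul_assoc, mul_smul_comm]
      rw [show (ε i j : K) * (ε j i * ε j k) = ε j k by rw [← mul_assoc, e4, one_mul],
        show (ε i j : K) * ((ε i k : K) * ε j k) = ε i k * ε j k * ε i j by ring,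
        mul_comm (ε j k : K) (ε i k)]
      abel⟩

/-- The right product `X z` of a homogeneous `ε`-derivation by a homogeneous element of the
`ε`-center, determined by `z (X a) = ε(|z|, |X|) (X z) a`. -/
def derMulCenter {ε : CommutationFactor K Γ} {𝒜 : Γ → Submodule K A}
    [SetLike.GradedMul 𝒜] {i s : Γ}
    (X : DerHom ε 𝒜 i) (z : epsCenter ε 𝒜 s) : DerHom ε 𝒜 (i + s) :=
  ⟨(ε i s : K) • (LinearMap.mulLeft K (z : A) ∘ₗ X.1), by
    obtain ⟨X, hX, hX'⟩ := X
    obtain ⟨z, hz, hz'⟩ := z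
    simp only [LinearMap.mul_apply'] at hX'
    refine Submodule.smul_mem _ _ ⟨fun k a ha => ?_, fun k a ha b => ?_⟩
    · rw [add_comm i s, add_assoc]
      exact SetLike.mul_mem_graded hz (hX k a ha)
    · have e : (ε (i + s) k : K) = ε i k * ε s k := by
        rw [ε.map_add_left, Units.val_mul]
      have hc : z * a = (ε s k : K) • (a * z) := sub_eq_zero.mp (hz' k a ha)
      simp only [LinearMap.mul_apply', LinearMap.comp_apply, LinearMap.mulLeft_apply,
        hX' k a ha, mul_add, mul_smul_comm, e, ← mul_assoc, hc, smul_mul_assoc, smul_smul]⟩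

variable [AddCommGroup M] [Module K M] [Module Aᵐᵒᵖ M] [IsScalarTower K Aᵐᵒᵖ M]

/-- The space `Ω^{n,k}(A, M)` of forms of degree `n` and of `Γ`-degree `k` with values in the
graded right module `M`: the `K`-multilinear maps `Der ε 𝒜 ^ n → M` homogeneous of degree `k`,
linear over the `ε`-center in the last argument and `ε`-antisymmetric. For `n = 0` these are the
constants in `ℳ k`. -/
def Forms (ε : CommutationFactor K Γ) (𝒜 : Γ → Submodule K A) [SetLike.GradedMul 𝒜]
    (ℳ : Γ → Submodule K M) (n : ℕ) (k : Γ) :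
    Submodule K (MultilinearMap K (fun _ : Fin n => Der ε 𝒜) M) where
  carrier := {ω | ∀ (deg : Fin n → Γ) (X : ∀ m, DerHom ε 𝒜 (deg m)),
    ω (fun m => toDer (X m)) ∈ ℳ (k + ∑ m, deg m) ∧
    (∀ i : Fin n, (i : ℕ) + 1 = n → ∀ (s : Γ) (z : epsCenter ε 𝒜 s),
      ω (Function.update (fun m => toDer (X m)) i (toDer (derMulCenter (X i) z))) =
        ω (fun m => toDer (X m)) <• (z : A)) ∧
    (∀ i j : Fin n, (i : ℕ) + 1 = j →
      ω (fun m => toDer (X m)) =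
        -((ε (deg i) (deg j) : K) • ω (fun m => toDer (X (Equiv.swap i j m)))))}
  zero_mem' := by
    intro deg X
    refine ⟨by simp, fun i _ s z => by simp, fun i j _ => by simp⟩
  add_mem' := by
    intro ω η hω hη deg X
    obtain ⟨h1, h2, h3⟩ := hω deg X
    obtain ⟨g1, g2, g3⟩ := hη deg X
    refine ⟨add_mem h1 g1, fun i hi s z => ?_, fun i j hij => ?_⟩
    · simp only [add_apply, h2 i hi s z, g2 i hi s z, smul_add]
    · rw [add_apply, add_apply, h3 i j hij, g3 i j hij, smul_add]
      abel
  smul_mem' := by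
    intro c ω hω deg X
    obtain ⟨h1, h2, h3⟩ := hω deg X
    refine ⟨Submodule.smul_mem _ c h1, fun i hi s z => ?_, fun i j hij => ?_⟩
    · simp only [smul_apply, h2 i hi s z]
      rw [← algebraMap_smul Aᵐᵒᵖ c, ← algebraMap_smul Aᵐᵒᵖ c, smul_smul, smul_smul,
        Algebra.commutes]
    · rw [smul_apply, smul_apply, h3 i j hij, smul_neg,
        smul_comm c]

/-- The total space `Ω(A, M)`. -/
abbrev Omega (ε : CommutationFactor K Γ) (𝒜 : Γ → Submodule K A) [SetLike.GradedMul 𝒜]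
    (ℳ : Γ → Submodule K M) :=
  ⨁ x : ℕ × Γ, Forms ε 𝒜 ℳ x.1 x.2

/-- The inclusion of `Ω^{n,k}(A, M)` in `Ω(A, M)`. -/
def toOmega [DecidableEq Γ] {ε : CommutationFactor K Γ} {𝒜 : Γ → Submodule K A}
    [SetLike.GradedMul 𝒜] {ℳ : Γ → Submodule K M} {n : ℕ} {k : Γ} :
    Forms ε 𝒜 ℳ n k →ₗ[K] Omega ε 𝒜 ℳ :=
  DirectSum.lof K (ℕ × Γ) (fun x => Forms ε 𝒜 ℳ x.1 x.2) (n, k)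

/-- The `ℤ × Γ`-grading of `Ω(A, M)`; the components of negative `ℤ`-degree are zero. -/
def omegaGrading [DecidableEq Γ] (ε : CommutationFactor K Γ) (𝒜 : Γ → Submodule K A)
    [SetLike.GradedMul 𝒜] (ℳ : Γ → Submodule K M) (x : ℤ × Γ) :
    Submodule K (Omega ε 𝒜 ℳ) :=
  ⨆ (n : ℕ) (_ : (n : ℤ) = x.1),
    LinearMap.range (toOmega : Forms ε 𝒜 ℳ n x.2 →ₗ[K] Omega ε 𝒜 ℳ)

/-- The right-hand side of the definition of the product (or action) `ω η` evaluated at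
homogeneous `ε`-derivations `X` of degrees `deg`. -/
noncomputable def productFormula {ε : CommutationFactor K Γ} {𝒜 : Γ → Submodule K A}
    [SetLike.GradedMul 𝒜] {ℳ : Γ → Submodule K M} {p q : ℕ} {k l : Γ}
    (ω : Forms ε 𝒜 ℳ p k) (η : Forms ε 𝒜 𝒜 q l)
    (deg : Fin (p + q) → Γ) (X : ∀ m, DerHom ε 𝒜 (deg m)) : M :=
  ((p.factorial : K) * (q.factorial : K))⁻¹ • ∑ σ : Equiv.Perm (Fin (p + q)),
    (((Equiv.Perm.sign σ : ℤ) : K) *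
      ((∏ x : Fin (p + q) × Fin (p + q) with x.1 < x.2 ∧ σ x.2 < σ x.1,
          ε (deg (σ x.2)) (deg (σ x.1)) : Kˣ) : K) *
      ((∏ m : Fin p, ε l (deg (σ (Fin.castAdd q m))) : Kˣ) : K)) •
    (ω.1 (fun m => toDer (X (σ (Fin.castAdd q m)))) <•
      η.1 (fun m => toDer (X (σ (Fin.natAdd p m)))))

/-- `act` is the bilinear extension of the product given by `productFormula`. -/
def IsFormProduct [DecidableEq Γ] (ε : CommutationFactor K Γ) (𝒜 : Γ → Submodule K A)
    [SetLike.GradedMul 𝒜] (ℳ : Γ → Submodule K M)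
    (act : Omega ε 𝒜 ℳ →ₗ[K] Omega ε 𝒜 𝒜 →ₗ[K] Omega ε 𝒜 ℳ) : Prop :=
  ∀ (p q : ℕ) (k l : Γ) (ω : Forms ε 𝒜 ℳ p k) (η : Forms ε 𝒜 𝒜 q l),
    ∃ θ : Forms ε 𝒜 ℳ (p + q) (k + l), act (toOmega ω) (toOmega η) = toOmega θ ∧
      ∀ (deg : Fin (p + q) → Γ) (X : ∀ m, DerHom ε 𝒜 (deg m)),
        θ.1 (fun m => toDer (X m)) = productFormula ω η deg X

/-- The part of the differential in which the derivations act on the values of `ω`. The index `m`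
starts at `0`, so that the sign is `(-1) ^ m`. -/
def diffActionSum {ε : CommutationFactor K Γ} {𝒜 : Γ → Submodule K A}
    [SetLike.GradedMul 𝒜] {p : ℕ} {k : Γ} (ω : Forms ε 𝒜 𝒜 p k)
    (deg : Fin (p + 1) → Γ) (X : ∀ m, DerHom ε 𝒜 (deg m)) : A :=
  ∑ m : Fin (p + 1), ((-1 : K) ^ (m : ℕ) *
    ((ε k (deg m) * ∏ a with a < m, ε (deg a) (deg m) : Kˣ) : K)) •
      (X m).1 (ω.1 (fun c => toDer (X (m.succAbove c))))

/-- The part of the differential which involves the brackets, that is, the sum over `m < n` of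
`± f ω([X_m, X_n], …)` with `X_m` and `X_n` omitted in the dots; it is empty on `0`-forms. Below,
`m : Fin (r + 1)` stands for the index `m.castSucc`, and `n.succAbove ∘ m.succAbove` enumerates
the indices different from `m.castSucc` and `n` increasingly. -/
def diffBracketSum {ε : CommutationFactor K Γ} {𝒜 : Γ → Submodule K A}
    [SetLike.GradedMul 𝒜] : {p : ℕ} → {k : Γ} → (ω : Forms ε 𝒜 𝒜 p k) →
    (deg : Fin (p + 1) → Γ) → (X : ∀ m, DerHom ε 𝒜 (deg m)) → A
  | 0, _, _, _, _ => 0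
  | r + 1, _, ω, deg, X =>
    ∑ n : Fin (r + 2), ∑ m : Fin (r + 1) with m.castSucc < n,
      ((-1 : K) ^ ((m : ℕ) + (n : ℕ)) *
        ((ε (deg n) (deg m.castSucc) *
          (∏ a with a < m.castSucc, ε (deg a) (deg m.castSucc)) *
          (∏ a with a < n, ε (deg a) (deg n)) : Kˣ) : K)) •
      ω.1 (Fin.cons (toDer (derBracket (X m.castSucc) (X n)))
        (fun c => toDer (X (n.succAbove (m.succAbove c)))))

/-- `d` is the linear extension of the differential given on homogeneous forms by its values at
homogeneous `ε`-derivations. -/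
def IsFormDifferential [DecidableEq Γ] (ε : CommutationFactor K Γ) (𝒜 : Γ → Submodule K A)
    [SetLike.GradedMul 𝒜] (d : Omega ε 𝒜 𝒜 →ₗ[K] Omega ε 𝒜 𝒜) : Prop :=
  ∀ (p : ℕ) (k : Γ) (ω : Forms ε 𝒜 𝒜 p k),
    ∃ θ : Forms ε 𝒜 𝒜 (p + 1) k, d (toOmega ω) = toOmega θ ∧
      ∀ (deg : Fin (p + 1) → Γ) (X : ∀ m, DerHom ε 𝒜 (deg m)),
        θ.1 (fun m => toDer (X m)) = diffActionSum ω deg X + diffBracketSum ω deg X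

/-- The unit `1 ∈ A`, seen as a `0`-form of `Γ`-degree `0`. -/
def omegaOne [DecidableEq Γ] (ε : CommutationFactor K Γ) (𝒜 : Γ → Submodule K A)
    [SetLike.GradedMonoid 𝒜] : Omega ε 𝒜 𝒜 :=
  toOmega (n := 0) (k := 0) ⟨MultilinearMap.constOfIsEmpty K _ (1 : A), fun deg X =>
    ⟨by simpa using SetLike.GradedOne.one_mem, fun i => i.elim0, fun i => i.elim0⟩⟩

end Forms

/-!
The forms of degree `n` are handled as functions of lists of homogeneous derivations (`HomDer`),
which vanish on the lists whose length is not `n`. On such functions, the insertion `i_X` of a first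
argument makes sense, and the product, the Lie derivatives and the differential can be defined by
recursion on the list of arguments, that is, by the rules of the Cartan calculus

* `i_X (ω η) = ε(|η|, |X|) (i_X ω) η + (-1) ^ p ω (i_X η)`,
* `i_Y L_X = ε(|X|, |Y|) L_X i_Y - i_[X, Y]`,
* `i_X d = L_X - d i_X`,

together with the values on the empty list. Every identity then has a short proof by induction: it
is enough to check it on the empty list and after an insertion. This gives the associativity of the
product (`wedge_assoc`), the commutation relation of the Lie derivatives, where the Jacobi identity
enters (`lieD_lieD`), `d L_X = L_X d` (`extD_lieD`), `d² = 0` (`extD_extD`) and the Leibniz rules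
(`lieD_wedge`, `extD_wedge`). That the operations preserve forms is also proved by induction
(`isForm_wedge`, `isForm_lieD`, `isForm_extD`): a function is a form as soon as its insertions are
forms and its first arguments behave well (`IsForm.of_succ`).

It remains to compare these operations with the explicit formulas. In the sum over `S_{p+q}`, the
terms are grouped by the position of the first argument (`altSum_cons`); by antisymmetry, all
positions among the arguments of `ω` contribute the same amount, and likewise for `η`, so that the
sum satisfies the recursion of the product up to the factor `p! q!` (`altSum_wedgeTerm`), which is
invertible in characteristic zero. Unfolding the recursion of the differential gives the two sums
over indices (`extD_ofFn`).

Finally, forms on `Der ε 𝒜` are the same as the functions of lists above (`formVal_injective`,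
`exists_formVal_eq`), because `Der ε 𝒜` is the direct sum of its homogeneous components
(`coeLinearMap_derHom_injective`). The operations on `Ω` are obtained from those on forms by
bilinear extension, which also gives their uniqueness.
-/

/-! ### Commutation factors -/

namespace CommutationFactor

variable {K Γ : Type*} [Field K] [AddCommGroup Γ] (ε : CommutationFactor K Γ)

theorem val_add_left (i j k : Γ) : (ε (i + j) k : K) = ε i k * ε j k := by
  rw [ε.map_add_left, Units.val_mul]

theorem val_add_right (i j k : Γ) : (ε i (j + k) : K) = ε i j * ε i k := by
  rw [ε.map_add_right, Units.val_mul]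

theorem val_swap (i j : Γ) : (ε i j : K) * ε j i = 1 := by
  rw [← Units.val_mul, ε.mul_swap, Units.val_one]

theorem val_zero_left (j : Γ) : (ε 0 j : K) = 1 := by
  have h := ε.map_add_left 0 0 j
  rw [add_zero, left_eq_mul] at h
  rw [h, Units.val_one]

theorem val_tilde_one_zero (p : ℕ) (k : Γ) : (ε.tilde (1, 0) ((p : ℤ), k) : K) = (-1) ^ p := by
  have h : ε.tilde (1, 0) ((p : ℤ), k) = (-1) ^ ((1 : ℤ) * p) * ε 0 k := rfl
  rw [h, Units.val_mul, ε.val_zero_left]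
  simp

end CommutationFactor

section Calculus

variable {K Γ A M : Type*} [Field K] [AddCommGroup Γ] [Ring A] [Algebra K A]

/-! ### Homogeneous derivations -/

/-- A homogeneous `ε`-derivation together with its degree. -/
abbrev HomDer (ε : CommutationFactor K Γ) (𝒜 : Γ → Submodule K A) :=
  Σ i, DerHom ε 𝒜 i

namespace HomDer

variable {ε : CommutationFactor K Γ} {𝒜 : Γ → Submodule K A}

/-- The linear map underlying a homogeneous `ε`-derivation. -/
abbrev map (X : HomDer ε 𝒜) : A →ₗ[K] A := X.2.1

/-- The bracket `[X, Y]_ε`, of degree `|X| + |Y|`. -/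
def bracket (X Y : HomDer ε 𝒜) : HomDer ε 𝒜 := ⟨X.1 + Y.1, derBracket X.2 Y.2⟩

/-- The product `X z` by a homogeneous element of the `ε`-center, of degree `|X| + |z|`. -/
def mulCenter [SetLike.GradedMul 𝒜] (X : HomDer ε 𝒜) {s : Γ} (z : epsCenter ε 𝒜 s) :
    HomDer ε 𝒜 := ⟨X.1 + s, derMulCenter X.2 z⟩

@[simp] theorem bracket_fst (X Y : HomDer ε 𝒜) : (bracket X Y).1 = X.1 + Y.1 := rfl

@[simp] theorem mulCenter_fst [SetLike.GradedMul 𝒜] (X : HomDer ε 𝒜) {s : Γ}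
    (z : epsCenter ε 𝒜 s) : (mulCenter X z).1 = X.1 + s := rfl

theorem bracket_map_apply (X Y : HomDer ε 𝒜) (a : A) :
    (bracket X Y).map a = X.map (Y.map a) - (ε X.1 Y.1 : K) • Y.map (X.map a) := rfl

theorem mulCenter_map_apply [SetLike.GradedMul 𝒜] (X : HomDer ε 𝒜) {s : Γ}
    (z : epsCenter ε 𝒜 s) (a : A) :
    (mulCenter X z).map a = (ε X.1 s : K) • ((z : A) * X.map a) := rfl

theorem map_mem (X : HomDer ε 𝒜) {j : Γ} {a : A} (ha : a ∈ 𝒜 j) : X.map a ∈ 𝒜 (X.1 + j) :=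
  X.2.2.1 j a ha

theorem map_mul (X : HomDer ε 𝒜) {j : Γ} {a : A} (ha : a ∈ 𝒜 j) (b : A) :
    X.map (a * b) = X.map a * b + (ε X.1 j : K) • (a * X.map b) :=
  X.2.2.2 j a ha b

/-- `X = a Y + b Z`, where `X`, `Y` and `Z` have the same degree. -/
structure IsComb (a b : K) (X Y Z : HomDer ε 𝒜) : Prop where
  deg_left : Y.1 = X.1
  deg_right : Z.1 = X.1
  map_eq : X.map = a • Y.map + b • Z.map

theorem IsComb.map_apply {a b : K} {X Y Z : HomDer ε 𝒜} (h : IsComb a b X Y Z) (c : A) :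
    X.map c = a • Y.map c + b • Z.map c := by
  rw [h.map_eq]; rfl

theorem IsComb.bracket_left {a b : K} {X Y Z : HomDer ε 𝒜} (h : IsComb a b X Y Z)
    (W : HomDer ε 𝒜) : IsComb a b (bracket X W) (bracket Y W) (bracket Z W) := by
  refine ⟨by simp [h.deg_left], by simp [h.deg_right], LinearMap.ext fun c => ?_⟩
  simp only [LinearMap.add_apply, LinearMap.smul_apply, bracket_map_apply, h.map_apply,
    h.deg_left, h.deg_right, map_add, map_smul]
  module

theorem IsComb.bracket_right {a b : K} {X Y Z : HomDer ε 𝒜} (h : IsComb a b X Y Z)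
    (W : HomDer ε 𝒜) : IsComb a b (bracket W X) (bracket W Y) (bracket W Z) := by
  refine ⟨by simp [h.deg_left], by simp [h.deg_right], LinearMap.ext fun c => ?_⟩
  simp only [LinearMap.add_apply, LinearMap.smul_apply, bracket_map_apply, h.map_apply,
    h.deg_left, h.deg_right, map_add, map_smul]
  module

/-- The `ε`-antisymmetry of the bracket. -/
theorem bracket_swap (X Y : HomDer ε 𝒜) :
    IsComb (-(ε X.1 Y.1 : K)) 0 (bracket X Y) (bracket Y X) (bracket Y X) := by
  refine ⟨add_comm _ _, add_comm _ _, LinearMap.ext fun c => ?_⟩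
  simp only [LinearMap.add_apply, LinearMap.smul_apply, bracket_map_apply]
  linear_combination (norm := module) -(ε.val_swap X.1 Y.1) • X.map (Y.map c)

/-- The `ε`-Jacobi identity. -/
theorem jacobi (X Y Z : HomDer ε 𝒜) :
    IsComb 1 (ε X.1 Y.1 : K) (bracket X (bracket Y Z)) (bracket (bracket X Y) Z)
      (bracket Y (bracket X Z)) := by
  refine ⟨add_assoc _ _ _, add_left_comm _ _ _, LinearMap.ext fun c => ?_⟩
  simp only [LinearMap.add_apply, LinearMap.smul_apply, bracket_map_apply, bracket_fst,
    ε.val_add_left, ε.val_add_right, map_sub, map_smul]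
  linear_combination (norm := module)
    (ε.val_swap X.1 Y.1) • (ε Y.1 Z.1 : K) • (X.map (Z.map (Y.map c)))
    -(ε.val_swap X.1 Y.1) • (ε X.1 Z.1 * ε Y.1 Z.1 : K) • (Z.map (X.map (Y.map c)))

end HomDer

theorem epsCenter_comm {ε : CommutationFactor K Γ} {𝒜 : Γ → Submodule K A} {s j : Γ}
    (z : epsCenter ε 𝒜 s) {b : A} (hb : b ∈ 𝒜 j) :
    (z : A) * b = (ε s j : K) • (b * (z : A)) :=
  sub_eq_zero.mp (z.2.2 j b hb)

namespace HomDer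

variable {ε : CommutationFactor K Γ} {𝒜 : Γ → Submodule K A}

/-- The `ε`-center is stable under `ε`-derivations. -/
theorem map_mem_epsCenter (X : HomDer ε 𝒜) {s : Γ} (z : epsCenter ε 𝒜 s) :
    X.map z ∈ epsCenter ε 𝒜 (X.1 + s) := by
  refine ⟨X.map_mem z.2.1, fun j b hb => ?_⟩
  have h := congrArg X.map (epsCenter_comm z hb)
  have h' := epsCenter_comm z (X.map_mem hb)
  rw [X.map_mul z.2.1, map_smul, X.map_mul hb, h'] at h
  rw [ε.val_add_left]
  simp only [ε.val_add_right] at h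
  linear_combination (norm := module) h -
    (ε.val_swap X.1 s) • (ε s j : K) • (X.map b * (z : A))

/-- The Leibniz rule `[X, Y z] = [X, Y] z + ε(|X|, |Y|) Y X(z)`. -/
theorem bracket_mulCenter [SetLike.GradedMul 𝒜] (X Y : HomDer ε 𝒜) {s : Γ}
    (z : epsCenter ε 𝒜 s) :
    IsComb 1 (ε X.1 Y.1 : K) (bracket X (mulCenter Y z)) (mulCenter (bracket X Y) z)
      (mulCenter Y (⟨X.map z, X.map_mem_epsCenter z⟩ : epsCenter ε 𝒜 (X.1 + s))) := by
  refine ⟨add_assoc _ _ _, add_left_comm _ _ _, LinearMap.ext fun c => ?_⟩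
  simp only [LinearMap.add_apply, LinearMap.smul_apply, bracket_map_apply, bracket_fst,
    mulCenter_fst, mulCenter_map_apply, ε.val_add_left, ε.val_add_right, map_smul,
    X.map_mul z.2.1, mul_sub, mul_smul_comm]
  linear_combination (norm := module)
    -(ε.val_swap X.1 Y.1) • (ε Y.1 s : K) • (X.map z * Y.map c)

end HomDer

end Calculus

section Calculus

variable {K Γ A M : Type*} [Field K] [AddCommGroup Γ] [Ring A] [Algebra K A]
  {ε : CommutationFactor K Γ} {𝒜 : Γ → Submodule K A}

open HomDer

/-! ### Insertion, product, Lie derivative and differential on functions of lists -/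

/-- The insertion of `X` as the first argument: `(i_X f)(X₁, …) = f(X, X₁, …)`. -/
def ins {H N : Type*} (X : H) (f : List H → N) : List H → N := fun L => f (X :: L)

@[simp] theorem ins_apply {H N : Type*} (X : H) (f : List H → N) (L : List H) :
    ins X f L = f (X :: L) := rfl

@[simp] theorem ins_zero {H N : Type*} [Zero N] (X : H) : ins X (0 : List H → N) = 0 := rfl

theorem ins_add {H N : Type*} [Add N] (X : H) (f g : List H → N) :
    ins X (f + g) = ins X f + ins X g := rfl

theorem ins_sub {H N : Type*} [Sub N] (X : H) (f g : List H → N) :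
    ins X (f - g) = ins X f - ins X g := rfl

theorem ins_smul {R H N : Type*} [SMul R N] (X : H) (c : R) (f : List H → N) :
    ins X (c • f) = c • ins X f := rfl

/-- Functions of lists agree if they agree on the empty list and after every insertion. This is the
induction step in the identities of the Cartan calculus. -/
theorem funext_ins {H N : Type*} {f g : List H → N} (h0 : f [] = g [])
    (h : ∀ X, ins X f = ins X g) : f = g := by
  funext L
  cases L with
  | nil => exact h0
  | cons X L => exact congrFun (h X) L

section Product

variable [AddCommGroup M] [Module K M] [Module Aᵐᵒᵖ M]

/-- The product of `ω` and `η`, where `l` is the `Γ`-degree of `η` and `s = (-1) ^ p` for `ω` of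
degree `p`. It is determined by the rule
`i_X (ω η) = ε(|η|, |X|) (i_X ω) η + (-1) ^ p ω (i_X η)`. -/
def wedge : K → Γ → (List (HomDer ε 𝒜) → M) → (List (HomDer ε 𝒜) → A) →
    List (HomDer ε 𝒜) → M
  | _, _, ω, η, [] => ω [] <• η []
  | s, l, ω, η, X :: L =>
    (ε l X.1 : K) • wedge (-s) l (ins X ω) η L + s • wedge s (l + X.1) ω (ins X η) L

variable (s : K) (l : Γ) (ω ω' : List (HomDer ε 𝒜) → M) (η η' : List (HomDer ε 𝒜) → A)

@[simp] theorem wedge_nil : wedge s l ω η [] = ω [] <• η [] := rfl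

theorem ins_wedge (X : HomDer ε 𝒜) : ins X (wedge s l ω η) =
    (ε l X.1 : K) • wedge (-s) l (ins X ω) η + s • wedge s (l + X.1) ω (ins X η) := rfl

theorem wedge_add_left : wedge s l (ω + ω') η = wedge s l ω η + wedge s l ω' η := by
  funext L
  induction L generalizing s l ω ω' η with
  | nil => simp
  | cons X L ih =>
    have h := ih (-s) l (ins X ω) (ins X ω') η
    have h' := ih s (l + X.1) ω ω' (ins X η)
    simp only [wedge, Pi.add_apply, ins_add] at h h' ⊢
    rw [h, h']
    module

theorem wedge_add_right : wedge s l ω (η + η') = wedge s l ω η + wedge s l ω η' := by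
  funext L
  induction L generalizing s l ω η η' with
  | nil => simp [add_smul]
  | cons X L ih =>
    have h := ih (-s) l (ins X ω) η η'
    have h' := ih s (l + X.1) ω (ins X η) (ins X η')
    simp only [wedge, Pi.add_apply, ins_add] at h h' ⊢
    rw [h, h']
    module

theorem wedge_sub_left : wedge s l (ω - ω') η = wedge s l ω η - wedge s l ω' η := by
  have h := wedge_add_left s l (ω - ω') ω' η
  rw [sub_add_cancel] at h
  rw [h, add_sub_cancel_right]

theorem wedge_sub_right : wedge s l ω (η - η') = wedge s l ω η - wedge s l ω η' := by
  have h := wedge_add_right s l ω (η - η') η'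
  rw [sub_add_cancel] at h
  rw [h, add_sub_cancel_right]

variable [IsScalarTower K Aᵐᵒᵖ M]

theorem wedge_smul_left (c : K) : wedge s l (c • ω) η = c • wedge s l ω η := by
  have := IsScalarTower.to_smulCommClass (R := K) (A := Aᵐᵒᵖ) (M := M)
  funext L
  induction L generalizing s l ω η with
  | nil => simp [smul_comm c]
  | cons X L ih =>
    have h := ih (-s) l (ins X ω) η
    have h' := ih s (l + X.1) ω (ins X η)
    simp only [wedge, Pi.smul_apply, ins_smul] at h h' ⊢
    rw [h, h']
    module

theorem wedge_smul_right (c : K) : wedge s l ω (c • η) = c • wedge s l ω η := by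
  funext L
  induction L generalizing s l ω η with
  | nil => simp
  | cons X L ih =>
    have h := ih (-s) l (ins X ω) η
    have h' := ih s (l + X.1) ω (ins X η)
    simp only [wedge, Pi.smul_apply, ins_smul] at h h' ⊢
    rw [h, h']
    module

theorem wedge_zero_left : wedge s l (0 : List (HomDer ε 𝒜) → M) η = 0 := by
  simpa using wedge_smul_left s l (0 : List (HomDer ε 𝒜) → M) η 0

theorem wedge_zero_right : wedge s l ω (0 : List (HomDer ε 𝒜) → A) = 0 := by
  simpa using wedge_smul_right s l ω (0 : List (HomDer ε 𝒜) → A) 0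

/-- The sign `(-1) ^ (p + q)` of a product of forms of degrees `p` and `q` appears as `s * t`. -/
theorem wedge_assoc (t : K) (r : Γ) (ζ : List (HomDer ε 𝒜) → A) :
    wedge (s * t) r (wedge s l ω η) ζ = wedge s (l + r) ω (wedge t r η ζ) := by
  funext L
  induction L generalizing s t l r ω η ζ with
  | nil => simp [smul_smul]
  | cons X L ih =>
    change ins X (wedge (s * t) r (wedge s l ω η) ζ) L =
      ins X (wedge s (l + r) ω (wedge t r η ζ)) L
    simp only [ins_wedge, wedge_add_left, wedge_smul_left, wedge_add_right, wedge_smul_right,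
      Pi.add_apply, Pi.smul_apply]
    rw [← neg_mul, ih, neg_mul, ← mul_neg, ih, ih, ε.val_add_left, add_right_comm l,
      ← add_assoc l]
    module

theorem wedge_one : wedge s 0 ω (fun L => if L = [] then 1 else 0) = ω := by
  have h : ∀ X : HomDer ε 𝒜, ins X (fun L => if L = [] then (1 : A) else 0) = 0 := by
    intro X; funext L; simp
  funext L
  induction L generalizing s ω with
  | nil => simp
  | cons X L ih =>
    change ins X (wedge s 0 ω _) L = _
    rw [ins_wedge, h, wedge_zero_right, ε.val_zero_left, Pi.add_apply, Pi.smul_apply, ih]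
    simp

end Product

theorem one_wedge (l : Γ) (η : List (HomDer ε 𝒜) → A) :
    wedge (1 : K) l (fun L => if L = [] then 1 else 0) η = η := by
  have h : ∀ X : HomDer ε 𝒜, ins X (fun L => if L = [] then (1 : A) else 0) = 0 := by
    intro X; funext L; simp
  funext L
  induction L generalizing l η with
  | nil => simp
  | cons X L ih =>
    change ins X (wedge 1 l _ η) L = _
    rw [ins_wedge, h, wedge_zero_left, Pi.add_apply, Pi.smul_apply, Pi.smul_apply, ih]
    simp

/-- The Lie derivative of `ω`, of `Γ`-degree `k`, along `X`. It is determined by `ε(k, |X|) X` on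
`0`-forms and by the rule `i_Y L_X = ε(|X|, |Y|) L_X i_Y - i_[X, Y]`. -/
def lieD (X : HomDer ε 𝒜) : Γ → (List (HomDer ε 𝒜) → A) → List (HomDer ε 𝒜) → A
  | k, ω, [] => (ε k X.1 : K) • X.map (ω [])
  | k, ω, Y :: L => (ε X.1 Y.1 : K) • lieD X (k + Y.1) (ins Y ω) L - ω (bracket X Y :: L)

/-- The exterior differential of `ω`, of `Γ`-degree `k`. It is determined by Cartan's formula
`i_X d = L_X - d i_X`. -/
def extD : Γ → (List (HomDer ε 𝒜) → A) → List (HomDer ε 𝒜) → A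
  | _, _, [] => 0
  | k, ω, X :: L => lieD X k ω L - extD (k + X.1) (ins X ω) L

variable (X Y : HomDer ε 𝒜) (k : Γ) (ω ω' : List (HomDer ε 𝒜) → A)

@[simp] theorem lieD_nil : lieD X k ω [] = (ε k X.1 : K) • X.map (ω []) := rfl

theorem ins_lieD : ins Y (lieD X k ω) =
    (ε X.1 Y.1 : K) • lieD X (k + Y.1) (ins Y ω) - ins (bracket X Y) ω := rfl

@[simp] theorem extD_nil : extD k ω [] = 0 := rfl

theorem ins_extD : ins X (extD k ω) = lieD X k ω - extD (k + X.1) (ins X ω) := rfl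

theorem lieD_add : lieD X k (ω + ω') = lieD X k ω + lieD X k ω' := by
  funext L
  induction L generalizing k ω ω' with
  | nil => simp
  | cons Y L ih =>
    have h := ih (k + Y.1) (ins Y ω) (ins Y ω')
    simp only [lieD, Pi.add_apply, ins_add] at h ⊢
    rw [h]
    module

theorem lieD_smul (c : K) : lieD X k (c • ω) = c • lieD X k ω := by
  funext L
  induction L generalizing k ω with
  | nil => simp [smul_comm c]
  | cons Y L ih =>
    have h := ih (k + Y.1) (ins Y ω)
    simp only [lieD, Pi.smul_apply, ins_smul] at h ⊢
    rw [h]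
    module

theorem lieD_zero : lieD X k 0 = 0 := by simpa using lieD_smul X k 0 0

theorem lieD_sub : lieD X k (ω - ω') = lieD X k ω - lieD X k ω' := by
  have h := lieD_add X k (ω - ω') ω'
  rw [sub_add_cancel] at h
  rw [h, add_sub_cancel_right]

theorem extD_add : extD k (ω + ω') = extD k ω + extD k ω' := by
  funext L
  induction L generalizing k ω ω' with
  | nil => simp
  | cons Y L ih =>
    have h := ih (k + Y.1) (ins Y ω) (ins Y ω')
    simp only [extD, Pi.add_apply, ins_add, lieD_add] at h ⊢
    rw [h]
    abel

theorem extD_smul (c : K) : extD k (c • ω) = c • extD k ω := by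
  funext L
  induction L generalizing k ω with
  | nil => simp
  | cons Y L ih =>
    have h := ih (k + Y.1) (ins Y ω)
    simp only [extD, Pi.smul_apply, ins_smul, lieD_smul] at h ⊢
    rw [h]
    module

theorem extD_zero : extD (ε := ε) (𝒜 := 𝒜) k 0 = 0 := by
  simpa using extD_smul (ε := ε) (𝒜 := 𝒜) k 0 0

theorem extD_sub : extD k (ω - ω') = extD k ω - extD k ω' := by
  have h := extD_add k (ω - ω') ω'
  rw [sub_add_cancel] at h
  rw [h, add_sub_cancel_right]

/-! ### Forms as functions of lists -/

section IsForm

variable (ε 𝒜) [SetLike.GradedMul 𝒜] [AddCommGroup M] [Module K M] [Module Aᵐᵒᵖ M]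

/-- A form of degree `n` and of `Γ`-degree `k`, seen as a function of lists of homogeneous
derivations which vanishes on the lists whose length is not `n`. Multilinearity is stated through
`IsComb`, since only derivations of the same degree can be added. -/
structure IsForm (ℳ : Γ → Submodule K M) (n : ℕ) (k : Γ) (f : List (HomDer ε 𝒜) → M) :
    Prop where
  supp : ∀ L, L.length ≠ n → f L = 0
  mem : ∀ L, f L ∈ ℳ (k + (L.map Sigma.fst).sum)
  lin : ∀ (L₁ L₂ : List (HomDer ε 𝒜)) {X Y Z : HomDer ε 𝒜} {a b : K}, IsComb a b X Y Z →
    f (L₁ ++ X :: L₂) = a • f (L₁ ++ Y :: L₂) + b • f (L₁ ++ Z :: L₂)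
  center : ∀ (L : List (HomDer ε 𝒜)) (X : HomDer ε 𝒜) {s : Γ} (z : epsCenter ε 𝒜 s),
    f (L ++ [mulCenter X z]) = f (L ++ [X]) <• (z : A)
  anti : ∀ (L₁ L₂ : List (HomDer ε 𝒜)) (X Y : HomDer ε 𝒜),
    f (L₁ ++ X :: Y :: L₂) = (-(ε X.1 Y.1 : K)) • f (L₁ ++ Y :: X :: L₂)

variable {ε 𝒜} {ℳ : Γ → Submodule K M} {n : ℕ} {k : Γ} {f g : List (HomDer ε 𝒜) → M}

namespace IsForm

theorem cast (h : IsForm ε 𝒜 ℳ n k f) {k' : Γ} (e : k = k') : IsForm ε 𝒜 ℳ n k' f := e ▸ h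

theorem zero : IsForm ε 𝒜 ℳ n k 0 := by
  constructor <;> intros <;> simp

theorem add (hf : IsForm ε 𝒜 ℳ n k f) (hg : IsForm ε 𝒜 ℳ n k g) :
    IsForm ε 𝒜 ℳ n k (f + g) where
  supp L h := by simp [hf.supp L h, hg.supp L h]
  mem L := add_mem (hf.mem L) (hg.mem L)
  lin L₁ L₂ X Y Z a b h := by
    simp only [Pi.add_apply, hf.lin L₁ L₂ h, hg.lin L₁ L₂ h]
    module
  center L X s z := by simp only [Pi.add_apply, hf.center, hg.center, smul_add]
  anti L₁ L₂ X Y := by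
    simp only [Pi.add_apply, hf.anti L₁ L₂ X, hg.anti L₁ L₂ X, smul_add]

theorem smul [IsScalarTower K Aᵐᵒᵖ M] (hf : IsForm ε 𝒜 ℳ n k f) (c : K) :
    IsForm ε 𝒜 ℳ n k (c • f) where
  supp L h := by simp [hf.supp L h]
  mem L := Submodule.smul_mem _ c (hf.mem L)
  lin L₁ L₂ X Y Z a b h := by
    simp only [Pi.smul_apply, hf.lin L₁ L₂ h]
    module
  center L X s z := by
    have := IsScalarTower.to_smulCommClass (R := K) (A := Aᵐᵒᵖ) (M := M)
    simp only [Pi.smul_apply, hf.center, smul_comm c]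
  anti L₁ L₂ X Y := by
    simp only [Pi.smul_apply, hf.anti L₁ L₂ X, smul_comm c]

theorem sub [IsScalarTower K Aᵐᵒᵖ M] (hf : IsForm ε 𝒜 ℳ n k f) (hg : IsForm ε 𝒜 ℳ n k g) :
    IsForm ε 𝒜 ℳ n k (f - g) := by
  simpa [sub_eq_add_neg] using hf.add (hg.smul (-1))

theorem nil_mem (hf : IsForm ε 𝒜 ℳ n k f) : f [] ∈ ℳ k := by
  simpa using hf.mem []

theorem nil_eq_zero (hf : IsForm ε 𝒜 ℳ (n + 1) k f) : f [] = 0 := hf.supp _ (by simp)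

theorem ins_eq_zero (hf : IsForm ε 𝒜 ℳ 0 k f) (X : HomDer ε 𝒜) : ins X f = 0 := by
  funext L
  exact hf.supp _ (by simp)

theorem ins (hf : IsForm ε 𝒜 ℳ (n + 1) k f) (X : HomDer ε 𝒜) :
    IsForm ε 𝒜 ℳ n (k + X.1) (ins X f) where
  supp L h := hf.supp _ (by simpa using h)
  mem L := by simpa [add_assoc] using hf.mem (X :: L)
  lin L₁ L₂ Y Z W a b h := hf.lin (X :: L₁) L₂ h
  center L Y s z := hf.center (X :: L) Y z
  anti L₁ L₂ Y Z := hf.anti (X :: L₁) L₂ Y Z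

theorem ins_comb (hf : IsForm ε 𝒜 ℳ n k f) {X Y Z : HomDer ε 𝒜} {a b : K}
    (h : IsComb a b X Y Z) : _root_.ins X f = a • _root_.ins Y f + b • _root_.ins Z f := by
  funext L
  exact hf.lin [] L h

theorem ins_ins (hf : IsForm ε 𝒜 ℳ n k f) (X Y : HomDer ε 𝒜) :
    _root_.ins Y (_root_.ins X f) =
      (-(ε X.1 Y.1 : K)) • _root_.ins X (_root_.ins Y f) := by
  funext L
  exact hf.anti [] L X Y

theorem of_zero (h0 : f [] ∈ ℳ k) (h : ∀ X, _root_.ins X f = 0) : IsForm ε 𝒜 ℳ 0 k f := by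
  have h' : ∀ L : List (HomDer ε 𝒜), L ≠ [] → f L = 0 := by
    rintro (_ | ⟨X, L⟩) hL
    · exact absurd rfl hL
    · exact congrFun (h X) L
  refine ⟨fun L hL => h' L (by simpa using hL), fun L => ?_, fun L₁ L₂ X Y Z a b _ => ?_,
    fun L X s z => ?_, fun L₁ L₂ X Y => ?_⟩
  · cases L with
    | nil => simpa using h0
    | cons X L => simp [h' (X :: L)]
  all_goals rw [h', h' _ (by simp)] <;> simp
  rw [h' _ (by simp), smul_zero]

/-- A function is a form of degree `n + 1` as soon as its insertions are forms of degree `n`, and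
it is linear and `ε`-antisymmetric in its first arguments. The linearity over the center then
needs a proof for `n = 0` only. -/
theorem of_succ (h0 : f [] = 0) (hins : ∀ X, IsForm ε 𝒜 ℳ n (k + X.1) (_root_.ins X f))
    (hlin : ∀ {X Y Z : HomDer ε 𝒜} {a b : K}, IsComb a b X Y Z →
      _root_.ins X f = a • _root_.ins Y f + b • _root_.ins Z f)
    (hanti : ∀ X Y : HomDer ε 𝒜, _root_.ins Y (_root_.ins X f) =
      (-(ε X.1 Y.1 : K)) • _root_.ins X (_root_.ins Y f))
    (hcenter : ∀ (X : HomDer ε 𝒜) {s : Γ} (z : epsCenter ε 𝒜 s),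
      f [mulCenter X z] = f [X] <• (z : A)) :
    IsForm ε 𝒜 ℳ (n + 1) k f := by
  refine ⟨fun L hL => ?_, fun L => ?_, fun L₁ L₂ X Y Z a b h => ?_,
    fun L X s z => ?_, fun L₁ L₂ X Y => ?_⟩
  · cases L with
    | nil => exact h0
    | cons X L => exact (hins X).supp L (by simpa using hL)
  · cases L with
    | nil => simp [h0]
    | cons X L => simpa [add_assoc] using (hins X).mem L
  · cases L₁ with
    | nil => exact congrFun (hlin h) L₂
    | cons W L₁ => exact (hins W).lin L₁ L₂ h
  · cases L with
    | nil => exact hcenter X z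
    | cons W L => exact (hins W).center L X z
  · cases L₁ with
    | nil => exact congrFun (hanti X Y) L₂
    | cons W L₁ => exact (hins W).anti L₁ L₂ X Y

end IsForm

end IsForm

end Calculus

section Calculus

variable {K Γ A M : Type*} [Field K] [AddCommGroup Γ] [Ring A] [Algebra K A]
  {ε : CommutationFactor K Γ} {𝒜 : Γ → Submodule K A}

open HomDer

/-! ### The operations preserve forms -/

section WedgeForm

variable [SetLike.GradedMul 𝒜] [AddCommGroup M] [Module K M] [Module Aᵐᵒᵖ M]
  [IsScalarTower K Aᵐᵒᵖ M] {ℳ : Γ → Submodule K M}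

/-- The product is `ε`-antisymmetric in its first two arguments because the two mixed terms
`(i_X ω) (i_Y η)` and `(i_Y ω) (i_X η)` are exchanged; the other properties follow by induction from
`IsForm.of_succ`. -/
theorem isForm_wedge (hℳ : ∀ i j, ∀ m ∈ ℳ i, ∀ a ∈ 𝒜 j, m <• a ∈ ℳ (i + j)) {p q : ℕ} {k l : Γ}
    {ω : List (HomDer ε 𝒜) → M} {η : List (HomDer ε 𝒜) → A} (s : K)
    (hω : IsForm ε 𝒜 ℳ p k ω) (hη : IsForm ε 𝒜 𝒜 q l η) :
    IsForm ε 𝒜 ℳ (p + q) (k + l) (wedge s l ω η) := by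
  obtain ⟨n, hn⟩ : ∃ n, p + q = n := ⟨_, rfl⟩
  rw [hn]
  induction n generalizing p q k l ω η s with
  | zero =>
    obtain ⟨rfl, rfl⟩ : p = 0 ∧ q = 0 := by omega
    refine .of_zero (hℳ _ _ _ hω.nil_mem _ hη.nil_mem) fun X => ?_
    rw [ins_wedge, hω.ins_eq_zero, hη.ins_eq_zero, wedge_zero_left, wedge_zero_right]
    simp
  | succ n ih =>
    have h1 : ∀ X, IsForm ε 𝒜 ℳ n (k + l + X.1) (wedge (-s) l (ins X ω) η) := by
      intro X
      cases p with
      | zero =>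
        rw [hω.ins_eq_zero, wedge_zero_left]
        exact .zero
      | succ p => exact (ih (-s) (hω.ins X) hη (by omega)).cast (by abel)
    have h2 : ∀ X, IsForm ε 𝒜 ℳ n (k + l + X.1) (wedge s (l + X.1) ω (ins X η)) := by
      intro X
      cases q with
      | zero =>
        rw [hη.ins_eq_zero, wedge_zero_right]
        exact .zero
      | succ q => exact (ih s hω (hη.ins X) (by omega)).cast (by abel)
    refine .of_succ ?_ (fun X => ?_) (fun {X Y Z a b} h => ?_) (fun X Y => ?_)
      fun X r z => ?_
    · rw [wedge_nil]
      rcases p with _ | p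
      · rcases q with _ | q
        · omega
        · rw [hη.nil_eq_zero, MulOpposite.op_zero, zero_smul]
      · rw [hω.nil_eq_zero, smul_zero]
    · rw [ins_wedge]
      exact ((h1 X).smul _).add ((h2 X).smul _)
    · simp only [ins_wedge, hω.ins_comb h, hη.ins_comb h, h.deg_left, h.deg_right,
        wedge_add_left, wedge_add_right, wedge_smul_left, wedge_smul_right]
      module
    · simp only [ins_wedge, ins_add, ins_smul, hω.ins_ins X Y, hη.ins_ins X Y,
        wedge_smul_left, wedge_smul_right, ε.val_add_left, add_right_comm l Y.1 X.1]
      linear_combination (norm := module)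
        -(ε.val_swap X.1 Y.1) • ((-s) * ε l X.1 : K) •
          wedge (-s) (l + Y.1) (ins X ω) (ins Y η)
    · have e1 := hω.center [] X z
      have e2 := hη.center [] X z
      have := IsScalarTower.to_smulCommClass (R := K) (A := Aᵐᵒᵖ) (M := M)
      simp only [List.nil_append] at e1 e2
      simp only [wedge, ins_apply, e1, e2, mulCenter_fst, ε.val_add_right, smul_add,
        smul_comm _ s, smul_comm _ (ε l X.1 : K), smul_smul, ← MulOpposite.op_mul,
        op_smul_eq_mul, epsCenter_comm z hη.nil_mem, MulOpposite.op_smul, smul_assoc]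
      rw [mul_assoc, ε.val_swap, mul_one]

end WedgeForm

section Derivative

variable [SetLike.GradedMul 𝒜] {n : ℕ} {k : Γ} {ω : List (HomDer ε 𝒜) → A}

theorem lieD_comb {X Y Z : HomDer ε 𝒜} {a b : K} (h : IsComb a b X Y Z)
    (hω : IsForm ε 𝒜 𝒜 n k ω) : lieD X k ω = a • lieD Y k ω + b • lieD Z k ω := by
  induction n generalizing k ω with
  | zero =>
    refine funext_ins ?_ fun W => ?_
    · simp only [lieD_nil, Pi.add_apply, Pi.smul_apply, h.map_apply, h.deg_left, h.deg_right]
      module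
    · simp only [ins_lieD, ins_add, ins_smul, hω.ins_eq_zero, lieD_zero]
      simp
  | succ n ih =>
    refine funext_ins ?_ fun W => ?_
    · simp [hω.nil_eq_zero]
    · simp only [ins_lieD, ins_add, ins_smul, ih (hω.ins W), h.deg_left, h.deg_right,
        hω.ins_comb (h.bracket_left W)]
      module

/-- Linearity over the center uses the Leibniz rule for `[X, Y z]` and the stability of the center
under `X`: the contributions of `X(z)` cancel. -/
theorem isForm_lieD (X : HomDer ε 𝒜) (hω : IsForm ε 𝒜 𝒜 n k ω) :
    IsForm ε 𝒜 𝒜 n (k + X.1) (lieD X k ω) := by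
  induction n generalizing k ω with
  | zero =>
    refine .of_zero ?_ fun Y => ?_
    · rw [add_comm k]
      exact Submodule.smul_mem _ _ (X.map_mem hω.nil_mem)
    · rw [ins_lieD, hω.ins_eq_zero, hω.ins_eq_zero, lieD_zero]
      simp
  | succ n ih =>
    refine .of_succ ?_ (fun Y => ?_) (fun {Y Z W a b} h => ?_) (fun Y Z => ?_)
      fun Y s z => ?_
    · simp [hω.nil_eq_zero]
    · rw [ins_lieD]
      exact (((ih (hω.ins Y)).cast (add_right_comm _ _ _)).smul _).sub
        ((hω.ins (bracket X Y)).cast (add_assoc _ _ _).symm)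
    · simp only [ins_lieD, hω.ins_comb h, hω.ins_comb (h.bracket_right X), lieD_add, lieD_smul,
        h.deg_left, h.deg_right]
      module
    · simp only [ins_lieD, ins_sub, ins_smul, hω.ins_ins (bracket X Y) Z,
        hω.ins_ins (bracket X Z) Y, hω.ins_ins Y Z, lieD_smul, bracket_fst, ε.val_add_left,
        add_right_comm k Z.1 Y.1]
      linear_combination (norm := module)
        (ε.val_swap Y.1 Z.1) • (ε X.1 Y.1 : K) • ins (bracket X Z) (ins Y ω)
    · have e1 := hω.center [] Y z
      have e2 := hω.center [] (bracket X Y) z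
      -- The second term of `[X, Y z] = [X, Y] z + ε(|X|, |Y|) Y X(z)` is a product by `X(z)`.
      have e3 := hω.center [] Y (⟨X.map z, X.map_mem_epsCenter z⟩ : epsCenter ε 𝒜 (X.1 + s))
      have e4 := hω.lin [] [] (bracket_mulCenter X Y z)
      have e5 : ω [Y] ∈ 𝒜 (k + Y.1) := by simpa using hω.mem [Y]
      simp only [List.nil_append] at e1 e2 e3 e4
      simp only [lieD, ins_apply, e1, e4, e2, e3, mulCenter_fst, ε.val_add_right,
        ε.val_add_left, op_smul_eq_mul, X.map_mul e5, sub_mul, smul_mul_assoc]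
      linear_combination (norm := module)
        (ε.val_swap X.1 s) • (ε X.1 Y.1 * ε k X.1 * ε Y.1 X.1 : K) • (X.map (ω [Y]) * (z : A))
        + (ε.val_swap X.1 s) • (ε X.1 Y.1 * ε k X.1 * ε X.1 k * ε Y.1 X.1 * ε X.1 Y.1 : K) •
          (ω [Y] * X.map z)
        + (ε.val_swap k X.1) • (ε X.1 Y.1 * ε Y.1 X.1 * ε X.1 Y.1 : K) • (ω [Y] * X.map z)
        + (ε.val_swap X.1 Y.1) • (ε X.1 Y.1 : K) • (ω [Y] * X.map z)

/-- Antisymmetry amounts to `i_Y i_X d = i_Y L_X - L_Y i_X + d i_Y i_X` and to the antisymmetry of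
the bracket. Linearity over the center matters only on `0`-forms, where it is that of `X ↦ X(a)`. -/
theorem isForm_extD (hω : IsForm ε 𝒜 𝒜 n k ω) : IsForm ε 𝒜 𝒜 (n + 1) k (extD k ω) := by
  induction n generalizing k ω with
  | zero =>
    have h : ∀ X, ins X (extD k ω) = lieD X k ω := fun X => by
      rw [ins_extD, hω.ins_eq_zero, extD_zero, sub_zero]
    have h' : ∀ X Y, ins Y (lieD X k ω) = 0 := fun X Y => (isForm_lieD X hω).ins_eq_zero Y
    refine .of_succ rfl (fun X => ?_) (fun {X Y Z a b} hc => ?_) (fun X Y => ?_) fun X s z => ?_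
    · rw [h]
      exact isForm_lieD X hω
    · simp only [h, lieD_comb hc hω]
    · rw [h, h, h', h', smul_zero]
    · simp only [extD, lieD_nil, sub_zero, mulCenter_map_apply, mulCenter_fst,
        ε.val_add_right, op_smul_eq_mul, epsCenter_comm z (X.map_mem hω.nil_mem), smul_mul_assoc]
      linear_combination (norm := module)
        (ε.val_swap k s) • (ε k X.1 * ε X.1 s * ε s X.1 : K) • (X.map (ω []) * (z : A))
        + (ε.val_swap X.1 s) • (ε k X.1 : K) • (X.map (ω []) * (z : A))
  | succ n ih =>
    refine .of_succ rfl (fun X => ?_) (fun {X Y Z a b} h => ?_) (fun X Y => ?_) fun X s z => ?_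
    · rw [ins_extD]
      exact (isForm_lieD X hω).sub (ih (hω.ins X))
    · simp only [ins_extD, lieD_comb h hω, hω.ins_comb h, extD_add, extD_smul, h.deg_left,
        h.deg_right]
      module
    · simp only [ins_extD, ins_sub, ins_lieD, hω.ins_ins X Y, hω.ins_comb (bracket_swap X Y),
        extD_smul, add_right_comm k Y.1 X.1]
      linear_combination (norm := module)
        (ε.val_swap X.1 Y.1) • lieD Y (k + X.1) (ins X ω)
    · simp [extD, lieD_nil, hω.nil_eq_zero]

/-! ### Cartan calculus -/

/-- The commutation relation of the Lie derivatives. The Jacobi identity enters through the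
linearity of forms in their arguments. -/
theorem lieD_lieD (X Y : HomDer ε 𝒜) (hω : IsForm ε 𝒜 𝒜 n k ω) :
    lieD Y (k + X.1) (lieD X k ω) =
      (ε X.1 Y.1 : K) • lieD X (k + Y.1) (lieD Y k ω) - lieD (bracket X Y) k ω := by
  induction n generalizing k ω with
  | zero =>
    refine funext_ins ?_ fun Z => ?_
    · simp only [lieD_nil, Pi.sub_apply, Pi.smul_apply, bracket_map_apply, bracket_fst,
        ε.val_add_left, ε.val_add_right, map_smul]
      linear_combination (norm := module)
        -(ε.val_swap X.1 Y.1) • (ε k X.1 * ε k Y.1 : K) • X.map (Y.map (ω []))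
    · simp only [ins_sub, ins_smul, ins_lieD, hω.ins_eq_zero, lieD_zero, smul_zero, sub_self]
  | succ n ih =>
    refine funext_ins ?_ fun Z => ?_
    · simp [hω.nil_eq_zero]
    · have h := ih (hω.ins Z)
      simp only [ins_sub, ins_smul, ins_lieD, lieD_sub, lieD_smul,
        hω.ins_comb (jacobi X Y Z), bracket_fst, ε.val_add_left, ε.val_add_right,
        add_right_comm k _ Z.1, ← add_assoc k] at h ⊢
      rw [h]
      linear_combination (norm := module)
        (ε.val_swap X.1 Y.1) • (ε Y.1 Z.1 : K) • lieD Y (k + Z.1 + X.1) (ins (bracket X Z) ω)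

/-- The differential commutes with the Lie derivatives, by Cartan's formula and the commutation
relation of the Lie derivatives. -/
theorem extD_lieD (X : HomDer ε 𝒜) (hω : IsForm ε 𝒜 𝒜 n k ω) :
    extD (k + X.1) (lieD X k ω) = lieD X k (extD k ω) := by
  induction n generalizing k ω with
  | zero =>
    refine funext_ins (by simp) fun Y => ?_
    simp only [ins_lieD, ins_extD, lieD_lieD X Y hω, hω.ins_eq_zero, lieD_zero, extD_zero,
      smul_zero, sub_zero]
  | succ n ih =>
    refine funext_ins (by simp) fun Y => ?_
    have h := ih (hω.ins Y)
    simp only [ins_lieD, ins_extD, lieD_lieD X Y hω, extD_sub, extD_smul, lieD_sub, bracket_fst,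
      add_right_comm k X.1 Y.1, ← add_assoc k] at h ⊢
    rw [h]
    module

/-- `d² = 0`: by Cartan's formula, `i_X d² = L_X d - d L_X + d² i_X`. -/
theorem extD_extD (hω : IsForm ε 𝒜 𝒜 n k ω) : extD k (extD k ω) = 0 := by
  induction n generalizing k ω with
  | zero =>
    refine funext_ins (by simp) fun X => ?_
    rw [ins_extD, ins_extD, extD_sub, extD_lieD X hω, hω.ins_eq_zero, extD_zero, extD_zero]
    simp
  | succ n ih =>
    refine funext_ins (by simp) fun X => ?_
    rw [ins_extD, ins_extD, extD_sub, extD_lieD X hω, ih (hω.ins X)]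
    simp

end Derivative

variable {k : Γ} {ω : List (HomDer ε 𝒜) → A}

/-- The Lie derivative is a derivation of the product. -/
theorem lieD_wedge (X : HomDer ε 𝒜) (s : K) {l : Γ} {η : List (HomDer ε 𝒜) → A}
    (hω : ∀ L, ω L ∈ 𝒜 (k + (L.map Sigma.fst).sum)) :
    lieD X (k + l) (wedge s l ω η) =
      (ε l X.1 : K) • wedge s l (lieD X k ω) η + wedge s (l + X.1) ω (lieD X l η) := by
  funext L
  induction L generalizing s k l ω η with
  | nil =>
    have h : ω [] ∈ 𝒜 k := by simpa using hω []
    simp only [lieD_nil, Pi.add_apply, Pi.smul_apply, wedge_nil, op_smul_eq_mul, X.map_mul h,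
      ε.val_add_left, smul_mul_assoc, mul_smul_comm]
    linear_combination (norm := module)
      (ε.val_swap k X.1) • (ε l X.1 : K) • (ω [] * X.map (η []))
  | cons Y L ih =>
    have h1 := ih (-s) (k := k + Y.1) (l := l) (ω := ins Y ω) (η := η)
      fun L => by simpa [add_assoc] using hω (Y :: L)
    have h2 := ih s (l := l + Y.1) (ω := ω) (η := ins Y η) hω
    change ins Y (lieD X (k + l) (wedge s l ω η)) L = ins Y
      ((ε l X.1 : K) • wedge s l (lieD X k ω) η + wedge s (l + X.1) ω (lieD X l η)) L
    rw [show k + (l + Y.1) = k + Y.1 + l by abel] at h2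
    simp only [ins_lieD, ins_wedge, ins_add, ins_smul, lieD_add, lieD_smul, wedge_sub_left,
      wedge_sub_right, wedge_smul_left, wedge_smul_right, Pi.add_apply, Pi.sub_apply,
      Pi.smul_apply, bracket_fst, ε.val_add_left, ε.val_add_right, add_right_comm k l Y.1,
      add_right_comm l Y.1 X.1, ← add_assoc l] at h1 h2 ⊢
    rw [h1, h2]
    linear_combination (norm := module)
      (ε.val_swap X.1 Y.1) • (s * ε l X.1 : K) • wedge s (l + Y.1) (lieD X k ω) (ins Y η) L

/-- The differential is an antiderivation of the product: after an insertion, the Lie derivatives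
are handled by `lieD_wedge` and the remaining terms by induction. -/
theorem extD_wedge (s : K) (hs : s * s = 1) {l : Γ} {η : List (HomDer ε 𝒜) → A}
    (hω : ∀ L, ω L ∈ 𝒜 (k + (L.map Sigma.fst).sum)) :
    extD (k + l) (wedge s l ω η) = wedge (-s) l (extD k ω) η + s • wedge s l ω (extD l η) := by
  funext L
  induction L generalizing s k l ω η with
  | nil => simp
  | cons X L ih =>
    have h1 := ih (-s) (by simpa using hs) (k := k + X.1) (l := l) (ω := ins X ω) (η := η)
      fun L => by simpa [add_assoc] using hω (X :: L)
    have h2 := ih s hs (l := l + X.1) (ω := ω) (η := ins X η) hω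
    change ins X (extD (k + l) (wedge s l ω η)) L = ins X
      (wedge (-s) l (extD k ω) η + s • wedge s l ω (extD l η)) L
    rw [show k + (l + X.1) = k + X.1 + l by abel] at h2
    simp only [ins_extD, lieD_wedge X s hω, ins_wedge, ins_add, ins_smul, extD_add, extD_smul,
      wedge_sub_left, wedge_sub_right, Pi.add_apply, Pi.sub_apply,
      Pi.smul_apply, add_right_comm k l X.1, neg_neg] at h1 h2 ⊢
    rw [h1, h2]
    linear_combination (norm := module)
      -hs • wedge s (l + X.1) ω (lieD X l η) L

end Calculus

/-! ### Correspondence between forms and functions of lists -/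

theorem ofFn_update {α : Type*} {n : ℕ} (Y : Fin n → α) (i : Fin n) (W : α) :
    List.ofFn (Function.update Y i W) = (List.ofFn Y).set i W := by
  refine List.ext_getElem (by simp) fun m h h' => ?_
  simp only [List.getElem_ofFn, List.getElem_set, Function.update_apply, Fin.ext_iff]
  simp only [eq_comm]

theorem ofFn_split {α : Type*} {n : ℕ} (Y : Fin n → α) {i j : Fin n} (hij : (i : ℕ) + 1 = j) :
    List.ofFn Y = (List.ofFn Y).take i ++ Y i :: Y j :: (List.ofFn Y).drop (i + 2) := by
  conv_lhs => rw [← List.take_append_drop i (List.ofFn Y)]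
  rw [List.drop_eq_getElem_cons (by simp), List.drop_eq_getElem_cons (by simp [hij])]
  have := j.2
  simp [hij]
  omega

theorem ofFn_comp_swap {α : Type*} {n : ℕ} (Y : Fin n → α) {i j : Fin n}
    (hij : (i : ℕ) + 1 = j) : List.ofFn (Y ∘ Equiv.swap i j) =
      (List.ofFn Y).take i ++ Y j :: Y i :: (List.ofFn Y).drop (i + 2) := by
  have hi : (i : ℕ) ≤ n := i.2.le
  conv_lhs => rw [Equiv.comp_swap_eq_update, ofFn_update, ofFn_update, ofFn_split Y hij, ← hij]
  simp [hi]

section Correspondence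

variable {K Γ A M : Type*} [Field K] [AddCommGroup Γ] [Ring A] [Algebra K A]
  {ε : CommutationFactor K Γ} {𝒜 : Γ → Submodule K A}

/-- A homogeneous derivation as an element of `Der ε 𝒜`. -/
def HomDer.der (X : HomDer ε 𝒜) : Der ε 𝒜 := toDer X.2

theorem HomDer.IsComb.der_eq {a b : K} {X Y Z : HomDer ε 𝒜} (h : IsComb a b X Y Z) :
    X.der = a • Y.der + b • Z.der := Subtype.ext h.map_eq

open HomDer

section FormVal

variable [SetLike.GradedMul 𝒜] [AddCommGroup M] [Module K M] [Module Aᵐᵒᵖ M]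
  [IsScalarTower K Aᵐᵒᵖ M] {ℳ : Γ → Submodule K M} {n : ℕ} {k : Γ}

/-- The values of a form on the lists of homogeneous derivations, extended by zero to the lists
whose length is not the degree of the form. -/
def formVal (ω : Forms ε 𝒜 ℳ n k) (L : List (HomDer ε 𝒜)) : M :=
  if h : L.length = n then ω.1 (fun m => (L.get (m.cast h.symm)).der) else 0

theorem formVal_ofFn (ω : Forms ε 𝒜 ℳ n k) (Y : Fin n → HomDer ε 𝒜) :
    formVal ω (List.ofFn Y) = ω.1 (fun m => (Y m).der) := by
  rw [formVal, dif_pos (List.length_ofFn)]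
  congr 1
  funext m
  simp

theorem formVal_ofFn_set (ω : Forms ε 𝒜 ℳ n k) (Y : Fin n → HomDer ε 𝒜) (i : Fin n)
    (W : HomDer ε 𝒜) : formVal ω ((List.ofFn Y).set i W) =
      ω.1 (Function.update (fun m => (Y m).der) i W.der) := by
  rw [← ofFn_update, formVal_ofFn]
  congr 1
  funext m
  exact Function.apply_update (fun _ X => HomDer.der X) Y i W m

theorem exists_ofFn_eq {α : Type*} (L : List α) {n : ℕ} (h : L.length = n) :
    ∃ Y : Fin n → α, L = List.ofFn Y := by
  subst h
  exact ⟨L.get, (List.ofFn_get L).symm⟩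

theorem formVal_smul (c : K) (ω : Forms ε 𝒜 ℳ n k) : formVal (c • ω) = c • formVal ω := by
  funext L
  by_cases h : L.length = n
  · simp only [formVal, dif_pos h, Pi.smul_apply]
    rfl
  · simp [formVal, dif_neg h]

theorem formVal_add (ω η : Forms ε 𝒜 ℳ n k) : formVal (ω + η) = formVal ω + formVal η := by
  funext L
  by_cases h : L.length = n
  · simp only [formVal, dif_pos h, Pi.add_apply]
    rfl
  · simp [formVal, dif_neg h]

theorem isForm_formVal (ω : Forms ε 𝒜 ℳ n k) : IsForm ε 𝒜 ℳ n k (formVal ω) := by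
  have hsupp : ∀ L : List (HomDer ε 𝒜), L.length ≠ n → formVal ω L = 0 :=
    fun L h => dif_neg h
  refine ⟨hsupp, fun L => ?_, fun L₁ L₂ X Y Z a b h => ?_, fun L X s z => ?_,
    fun L₁ L₂ X Y => ?_⟩
  · by_cases hL : L.length = n
    · obtain ⟨T, rfl⟩ := exists_ofFn_eq L hL
      rw [formVal_ofFn, List.map_ofFn, List.sum_ofFn]
      exact (ω.2 (fun m => (T m).1) fun m => (T m).2).1
    · rw [hsupp L hL]
      exact zero_mem _
  · by_cases hL : (L₁ ++ X :: L₂).length = n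
    · obtain ⟨T, hT⟩ := exists_ofFn_eq _ hL
      have hi : L₁.length < n := by simp at hL; omega
      have hset : ∀ W, L₁ ++ W :: L₂ = (List.ofFn T).set (⟨L₁.length, hi⟩ : Fin n) W := by
        intro W
        rw [← hT]
        simp
      rw [hset X, hset Y, hset Z, formVal_ofFn_set, formVal_ofFn_set, formVal_ofFn_set,
        h.der_eq, MultilinearMap.map_update_add, MultilinearMap.map_update_smul,
        MultilinearMap.map_update_smul]
    · simp only [List.length_append, List.length_cons] at hL
      rw [hsupp _ (by simpa using hL), hsupp _ (by simpa using hL), hsupp _ (by simpa using hL)]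
      simp
  · by_cases hL : (L ++ [X]).length = n
    · obtain ⟨T, hT⟩ := exists_ofFn_eq _ hL
      have hi : L.length < n := by simp at hL; omega
      have hset : ∀ W, L ++ [W] = (List.ofFn T).set (⟨L.length, hi⟩ : Fin n) W := by
        intro W
        rw [← hT]
        simp
      have hX : X = T ⟨L.length, hi⟩ := by
        have : (List.ofFn T)[L.length]'(by simpa using hi) = X := by simp [← hT]
        simpa using this.symm
      rw [hset (mulCenter X z), hT, formVal_ofFn_set, formVal_ofFn, hX]
      exact (ω.2 (fun m => (T m).1) fun m => (T m).2).2.1 ⟨L.length, hi⟩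
        (by simpa using hL) s z
    · rw [hsupp _ (by simpa using hL), hsupp _ (by simpa using hL), smul_zero]
  · by_cases hL : (L₁ ++ X :: Y :: L₂).length = n
    · obtain ⟨T, hT⟩ := exists_ofFn_eq _ hL
      have hi : L₁.length < n := by simp at hL; omega
      have hj : L₁.length + 1 < n := by simp at hL; omega
      have hX : X = T ⟨L₁.length, hi⟩ := by
        have : (List.ofFn T)[L₁.length]'(by simpa using hi) = X := by simp [← hT]
        simpa using this.symm
      have hY : Y = T ⟨L₁.length + 1, hj⟩ := by
        have : (List.ofFn T)[L₁.length + 1]'(by simpa using hj) = Y := by simp [← hT]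
        simpa using this.symm
      have hswap : L₁ ++ Y :: X :: L₂ =
          List.ofFn (T ∘ Equiv.swap ⟨L₁.length, hi⟩ ⟨L₁.length + 1, hj⟩) := by
        rw [Equiv.comp_swap_eq_update, ofFn_update, ofFn_update, ← hT, ← hX, ← hY]
        simp
      rw [hswap, hT, formVal_ofFn, formVal_ofFn, hX, hY, neg_smul]
      exact (ω.2 (fun m => (T m).1) fun m => (T m).2).2.2 ⟨L₁.length, hi⟩
        ⟨L₁.length + 1, hj⟩ rfl
    · rw [hsupp _ (by simpa using hL), hsupp _ (by simpa using hL), smul_zero]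

end FormVal

section FormOf

variable [DecidableEq Γ] [GradedAlgebra 𝒜]

/-- The sum of the spaces of homogeneous derivations is direct: on `a ∈ 𝒜 j`, the component of
degree `i` of a derivation is the component of degree `i + j` of its value. -/
theorem coeLinearMap_derHom_injective :
    Function.Injective (DirectSum.coeLinearMap (DerHom ε 𝒜)) := by
  -- The component of degree `i` is recovered from the values of the sum.
  have key : ∀ (f : ⨁ i, DerHom ε 𝒜 i) (i j : Γ) (a : A), a ∈ 𝒜 j →
      (DirectSum.decompose 𝒜 (DirectSum.coeLinearMap (DerHom ε 𝒜) f a) (i + j) : A) =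
        (f i).1 a := by
    intro f i j a ha
    induction f using DirectSum.induction_on with
    | zero => simp
    | of i' x =>
      rw [← DirectSum.lof_eq_of K, DirectSum.coeLinearMap_lof]
      by_cases h : i' = i
      · subst h
        rw [DirectSum.lof_apply, DirectSum.decompose_of_mem_same _ (x.2.1 j a ha)]
      · rw [DirectSum.decompose_of_mem_ne _ (x.2.1 j a ha) (by simpa using h),
          DirectSum.lof_eq_of, DirectSum.of_eq_of_ne _ _ _ (Ne.symm h)]
        rfl
    | add f g hf hg =>
      rw [map_add, LinearMap.add_apply, DirectSum.decompose_add, DirectSum.add_apply,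
        DirectSum.add_apply, Submodule.coe_add, Submodule.coe_add, hf, hg]
      rfl
  intro f g h
  refine DFinsupp.ext fun i => Subtype.ext (LinearMap.ext fun a => ?_)
  induction a using DirectSum.Decomposition.inductionOn 𝒜 with
  | zero => simp
  | homogeneous a =>
    have h1 := key f i _ a a.2
    have h2 := key g i _ a a.2
    rw [h] at h1
    exact h1.symm.trans h2
  | add a b ha hb => rw [map_add, map_add, ha, hb]

variable (ε 𝒜) in
/-- The decomposition of the space of derivations into its homogeneous components. -/
noncomputable def derEquiv : Der ε 𝒜 ≃ₗ[K] ⨁ i, DerHom ε 𝒜 i :=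
  ((LinearEquiv.ofInjective _ coeLinearMap_derHom_injective).trans
    (LinearEquiv.ofEq _ (Der ε 𝒜) DirectSum.range_coeLinearMap)).symm

theorem derEquiv_der (X : HomDer ε 𝒜) :
    derEquiv ε 𝒜 X.der = DirectSum.lof K Γ (fun i => DerHom ε 𝒜 i) X.1 X.2 := by
  rw [derEquiv, LinearEquiv.symm_apply_eq]
  refine Subtype.ext ?_
  change (X.2 : A →ₗ[K] A) = DirectSum.coeLinearMap (DerHom ε 𝒜) (DirectSum.lof K Γ _ X.1 X.2)
  rw [DirectSum.coeLinearMap_lof]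

variable [AddCommGroup M] [Module K M] [Module Aᵐᵒᵖ M]
  [IsScalarTower K Aᵐᵒᵖ M] {ℳ : Γ → Submodule K M} {n : ℕ} {k : Γ}

/-- A form is determined by its values on homogeneous derivations. -/
theorem formVal_injective : Function.Injective (formVal : Forms ε 𝒜 ℳ n k → _) := by
  intro ω η h
  refine Subtype.ext ?_
  have hfam : ω.1.compLinearMap (fun _ => (derEquiv ε 𝒜).symm.toLinearMap) =
      η.1.compLinearMap (fun _ => (derEquiv ε 𝒜).symm.toLinearMap) := by
    refine MultilinearMap.fromDirectSumEquiv.symm.injective ?_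
    funext deg
    refine MultilinearMap.ext fun X => ?_
    have e : ∀ m, (derEquiv ε 𝒜).symm (DirectSum.lof K Γ (fun i => DerHom ε 𝒜 i) (deg m) (X m))
        = HomDer.der (⟨deg m, X m⟩ : HomDer ε 𝒜) := fun m => by
      rw [LinearEquiv.symm_apply_eq, derEquiv_der]
    rw [MultilinearMap.fromDirectSumEquiv_symm_apply,
      MultilinearMap.fromDirectSumEquiv_symm_apply]
    simp only [MultilinearMap.compLinearMap_apply, LinearEquiv.coe_coe, e]
    rw [← formVal_ofFn ω (fun m => ⟨deg m, X m⟩), ← formVal_ofFn η (fun m => ⟨deg m, X m⟩), h]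
  refine MultilinearMap.ext fun X => ?_
  have := congrArg (fun F => F fun m => derEquiv ε 𝒜 (X m)) hfam
  simpa using this

/-- Every function of lists which is a form comes from a form: its restrictions to tuples of given
degrees are multilinear, and the decomposition of `Der ε 𝒜` glues them. -/
theorem exists_formVal_eq {f : List (HomDer ε 𝒜) → M} (hf : IsForm ε 𝒜 ℳ n k f) :
    ∃ θ : Forms ε 𝒜 ℳ n k, formVal θ = f := by
  have hset : ∀ (deg : Fin n → Γ) (X : ∀ m, DerHom ε 𝒜 (deg m)) (i : Fin n)
      (x : DerHom ε 𝒜 (deg i)),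
      f (List.ofFn fun m => (⟨deg m, Function.update X i x m⟩ : HomDer ε 𝒜)) =
        f ((List.ofFn fun m => (⟨deg m, X m⟩ : HomDer ε 𝒜)).take i ++ ⟨deg i, x⟩ ::
          (List.ofFn fun m => (⟨deg m, X m⟩ : HomDer ε 𝒜)).drop (i + 1)) := by
    intro deg X i x
    have h : (fun m => (⟨deg m, Function.update X i x m⟩ : HomDer ε 𝒜)) =
        Function.update (fun m => (⟨deg m, X m⟩ : HomDer ε 𝒜)) i ⟨deg i, x⟩ := by
      funext m
      exact Function.apply_update (fun m y => (⟨deg m, y⟩ : HomDer ε 𝒜)) X i x m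
    rw [h, ofFn_update, List.set_eq_take_append_cons_drop, if_pos (by simp)]
  -- The restriction of `f` to the tuples of given degrees.
  let fam : ∀ deg : Fin n → Γ, MultilinearMap K (fun m => DerHom ε 𝒜 (deg m)) M := fun deg =>
    { toFun := fun X => f (List.ofFn fun m => ⟨deg m, X m⟩)
      map_update_add' := by
        intro dec X i x y
        obtain rfl := Subsingleton.elim dec (instDecidableEqFin n)
        rw [hset, hset, hset, hf.lin _ _ (a := 1) (b := 1) (X := ⟨deg i, x + y⟩) (Y := ⟨deg i, x⟩)
          (Z := ⟨deg i, y⟩) ⟨rfl, rfl, by simp [HomDer.map]⟩, one_smul, one_smul]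
      map_update_smul' := by
        intro dec X i c x
        obtain rfl := Subsingleton.elim dec (instDecidableEqFin n)
        rw [hset, hset, hf.lin _ _ (a := c) (b := 0) (X := ⟨deg i, c • x⟩) (Y := ⟨deg i, x⟩)
          (Z := ⟨deg i, x⟩) ⟨rfl, rfl, by simp [HomDer.map]⟩, zero_smul, add_zero] }
  let θ : MultilinearMap K (fun _ : Fin n => Der ε 𝒜) M :=
    (MultilinearMap.fromDirectSumEquiv fam).compLinearMap
      fun _ => (derEquiv ε 𝒜).toLinearMap
  have hθ : ∀ Y : Fin n → HomDer ε 𝒜, θ (fun m => (Y m).der) = f (List.ofFn Y) := by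
    intro Y
    simp only [θ, MultilinearMap.compLinearMap_apply, LinearEquiv.coe_coe, derEquiv_der]
    rw [MultilinearMap.fromDirectSumEquiv_lof]
    rfl
  refine ⟨⟨θ, fun deg X => ?_⟩, ?_⟩
  · let Y : Fin n → HomDer ε 𝒜 := fun m => ⟨deg m, X m⟩
    refine ⟨?_, fun i hi s z => ?_, fun i j hij => ?_⟩
    · have h := hf.mem (List.ofFn Y)
      rw [← hθ, List.map_ofFn, List.sum_ofFn] at h
      exact h
    · have h : (fun m => (Function.update Y i (mulCenter (Y i) z) m).der) =
          Function.update (fun m => toDer (X m)) i (toDer (derMulCenter (X i) z)) := by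
        funext m
        exact Function.apply_update (fun _ W => HomDer.der W) Y i _ m
      have h' : List.ofFn Y = (List.ofFn Y).take i ++ [Y i] := by
        conv_lhs => rw [← Function.update_eq_self i Y, ofFn_update,
          List.set_eq_take_append_cons_drop, if_pos (by simp), hi]
        simp
      rw [← h, hθ, ofFn_update, List.set_eq_take_append_cons_drop, if_pos (by simp), hi,
        List.drop_eq_nil_of_le (by simp), hf.center, ← h', ← hθ]
      rfl
    · rw [← neg_smul]
      have h1 := hθ (Y ∘ Equiv.swap i j)
      have h2 := hθ Y
      rw [ofFn_split Y hij] at h2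
      rw [ofFn_comp_swap Y hij] at h1
      exact (h2.trans (hf.anti _ _ _ _)).trans (congrArg _ h1.symm)
  · funext L
    by_cases hL : L.length = n
    · obtain ⟨T, rfl⟩ := exists_ofFn_eq L hL
      rw [formVal_ofFn, hθ]
    · rw [hf.supp L hL, (isForm_formVal _).supp L hL]

end FormOf

end Correspondence

/-! ### Sums over permutations -/

theorem ofFn_insertNth {α : Type*} {n : ℕ} (j : Fin (n + 1)) (x : α) (Z : Fin n → α) :
    List.ofFn (j.insertNth x Z : Fin (n + 1) → α) =
      (List.ofFn Z).take j ++ x :: (List.ofFn Z).drop j := by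
  have hj : (j : ℕ) ≤ n := by omega
  refine List.ext_getElem (by simp; omega) fun m h h' => ?_
  have hm : m < n + 1 := by simpa using h
  rw [List.getElem_ofFn, List.getElem_append]
  rcases lt_trichotomy m j with h1 | h1 | h1
  · have e : (⟨m, hm⟩ : Fin (n + 1)) = j.succAbove ⟨m, by omega⟩ := by
      rw [Fin.succAbove_of_castSucc_lt _ _ (by simpa [Fin.lt_def] using h1)]
      rfl
    rw [e, Fin.insertNth_apply_succAbove, dif_pos (by simp; omega)]
    simp
  · have e : (⟨m, hm⟩ : Fin (n + 1)) = j := Fin.ext h1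
    rw [e, Fin.insertNth_apply_same, dif_neg (by simp; omega)]
    simp [h1, hj]
  · obtain ⟨m, rfl⟩ : ∃ m', m = m' + 1 := ⟨m - 1, by omega⟩
    have e : (⟨m + 1, hm⟩ : Fin (n + 1)) = j.succAbove ⟨m, by omega⟩ := by
      rw [Fin.succAbove_of_le_castSucc _ _ (by simp [Fin.le_def]; omega)]
      rfl
    rw [e, Fin.insertNth_apply_succAbove, dif_neg (by simp; omega), List.getElem_cons,
      dif_neg (by simp; omega)]
    simp only [List.getElem_drop, List.getElem_ofFn]
    congr 2
    simp
    omega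

/-- The permutation `σ` of `Fin (n + 1)` with `σ j = 0` which is given by the permutation `e` of
`Fin n` on the other indices. -/
def insertZeroPerm {n : ℕ} (x : Fin (n + 1) × Equiv.Perm (Fin n)) : Equiv.Perm (Fin (n + 1)) :=
  (finSuccEquiv' x.1).trans ((Equiv.optionCongr x.2).trans (finSuccEquiv n).symm)

theorem insertZeroPerm_self {n : ℕ} (j : Fin (n + 1)) (e : Equiv.Perm (Fin n)) :
    insertZeroPerm (j, e) j = 0 := by
  simp [insertZeroPerm]

theorem insertZeroPerm_succAbove {n : ℕ} (j : Fin (n + 1)) (e : Equiv.Perm (Fin n))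
    (m : Fin n) : insertZeroPerm (j, e) (j.succAbove m) = (e m).succ := by
  simp [insertZeroPerm]

theorem insertZeroPerm_bijective (n : ℕ) :
    Function.Bijective (insertZeroPerm : Fin (n + 1) × Equiv.Perm (Fin n) → _) := by
  rw [Fintype.bijective_iff_injective_and_card]
  refine ⟨?_, by simp [Fintype.card_perm, Nat.factorial_succ]⟩
  rintro ⟨j, e⟩ ⟨j', e'⟩ h
  obtain rfl : j = j' := by
    refine (insertZeroPerm (j', e')).injective ?_
    rw [← h, insertZeroPerm_self, h, insertZeroPerm_self]
  refine Prod.ext rfl (Equiv.ext fun m => ?_)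
  have hm := congrArg (fun σ => σ (j.succAbove m)) h
  simpa only [insertZeroPerm_succAbove, Fin.succ_inj] using hm

section AltSum

variable {K α M : Type*} [Field K] [AddCommGroup M] [Module K M]

/-- The sum over all permutations `σ` of the values of `F` at `Y ∘ σ`, with one factor `C` for each
inversion of `σ`. -/
def altSum (C : α → α → K) (F : List α → M) {n : ℕ} (Y : Fin n → α) : M :=
  ∑ σ : Equiv.Perm (Fin n), (∏ b, ∏ a, if a < b then
    (if σ a < σ b then 1 else C (Y (σ b)) (Y (σ a))) else 1) • F (List.ofFn (Y ∘ σ))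

theorem altSum_congr (C : α → α → K) {F G : List α → M} {n : ℕ} (Y : Fin n → α)
    (h : ∀ L, L.length = n → F L = G L) : altSum C F Y = altSum C G Y :=
  Finset.sum_congr rfl fun σ _ => by rw [h _ (by simp)]

theorem altSum_smul (C : α → α → K) (c : K) (F : List α → M) {n : ℕ} (Y : Fin n → α) :
    altSum C (fun L => c • F L) Y = c • altSum C F Y := by
  rw [altSum, altSum, Finset.smul_sum]
  exact Finset.sum_congr rfl fun σ _ => smul_comm _ _ _

/-- Expansion of the sum over all permutations along the position `j` of the first argument. -/
theorem altSum_cons (C : α → α → K) (F : List α → M) {n : ℕ} (x : α) (Y : Fin n → α) :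
    altSum C F (Fin.cons x Y : Fin (n + 1) → α) = ∑ j : Fin (n + 1),
      altSum C (fun L => ((L.take j).map (C x)).prod • F (L.take j ++ x :: L.drop j)) Y := by
  rw [altSum, ← (insertZeroPerm_bijective n).sum_comp, Fintype.sum_prod_type]
  refine Finset.sum_congr rfl fun j _ => ?_
  rw [altSum]
  refine Finset.sum_congr rfl fun e _ => ?_
  have hY : (Fin.cons x Y : Fin (n + 1) → α) ∘ insertZeroPerm (j, e) = j.insertNth x (Y ∘ e) := by
    rw [Fin.eq_insertNth_iff]
    refine ⟨by simp [insertZeroPerm_self], ?_⟩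
    funext m
    simp [Fin.removeNth, insertZeroPerm_succAbove]
  rw [hY, ofFn_insertNth, smul_smul]
  congr 1
  rw [Fin.prod_univ_succAbove _ j]
  simp only [Fin.prod_univ_succAbove _ j, insertZeroPerm_self, insertZeroPerm_succAbove,
    lt_self_iff_false, if_false, one_mul, Fin.cons_zero, Fin.cons_succ, Fin.succ_lt_succ_iff,
    Fin.succ_pos, if_true, ite_self, Fin.not_lt_zero, (Fin.strictMono_succAbove j).lt_iff_lt,
    Fin.succAbove_lt_iff_castSucc_lt]
  simp only [Fin.lt_def, Fin.val_castSucc]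
  rw [mul_comm, List.map_take, List.map_ofFn, List.prod_take_ofFn, Finset.prod_filter]
  rfl

end AltSum

section ProductFormula

variable {K Γ A M : Type*} [Field K] [AddCommGroup Γ] [Ring A] [Algebra K A]
  {ε : CommutationFactor K Γ} {𝒜 : Γ → Submodule K A} [SetLike.GradedMul 𝒜]
  [AddCommGroup M] [Module K M] [Module Aᵐᵒᵖ M] {ℳ : Γ → Submodule K M}

/-- An argument moves past a list of arguments by adjacent transpositions. -/
theorem IsForm.move {n : ℕ} {k : Γ} {f : List (HomDer ε 𝒜) → M} (hf : IsForm ε 𝒜 ℳ n k f)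
    (X : HomDer ε 𝒜) (L₁ L₂ : List (HomDer ε 𝒜)) :
    f (X :: (L₁ ++ L₂)) = (L₁.map fun Y => (-(ε X.1 Y.1 : K))).prod • f (L₁ ++ X :: L₂) := by
  suffices h : ∀ L₀ : List (HomDer ε 𝒜), f (L₀ ++ X :: (L₁ ++ L₂)) =
      (L₁.map fun Y => (-(ε X.1 Y.1 : K))).prod • f (L₀ ++ (L₁ ++ X :: L₂)) from h []
  induction L₁ with
  | nil => simp
  | cons Y L₁ ih =>
    intro L₀
    have h := ih (L₀ ++ [Y])
    simp only [List.append_assoc, List.singleton_append] at h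
    rw [List.cons_append, hf.anti, h, List.map_cons, List.prod_cons, mul_smul, List.cons_append]

/-- The summand of the product formula for the identity permutation. -/
def wedgeTerm (p : ℕ) (l : Γ) (ω : List (HomDer ε 𝒜) → M) (η : List (HomDer ε 𝒜) → A)
    (L : List (HomDer ε 𝒜)) : M :=
  ((L.take p).map fun X => (ε l X.1 : K)).prod • (ω (L.take p) <• η (L.drop p))

variable [IsScalarTower K Aᵐᵒᵖ M]

/-- Inserting `X` among the arguments of `ω` moves it to the front of `ω`; the factor `ε(l, |X|)`
remains. -/
theorem wedgeTerm_insert_left {p n : ℕ} {k l : Γ} {ω : List (HomDer ε 𝒜) → M}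
    (hω : IsForm ε 𝒜 ℳ n k ω) (η : List (HomDer ε 𝒜) → A) (X : HomDer ε 𝒜)
    (L : List (HomDer ε 𝒜)) (hp : p ≤ L.length) {j : ℕ} (hj : j ≤ p) :
    ((L.take j).map fun Y => (-(ε X.1 Y.1 : K))).prod •
        wedgeTerm (p + 1) l ω η (L.take j ++ X :: L.drop j) =
      (ε l X.1 : K) • wedgeTerm p l (ins X ω) η L := by
  obtain ⟨L, L₃, rfl, rfl⟩ : ∃ L' L₃, L'.length = p ∧ L = L' ++ L₃ :=
    ⟨L.take p, L.drop p, by simpa using hp, by simp⟩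
  obtain ⟨L₁, L₂, rfl, rfl⟩ : ∃ L₁ L₂, L₁.length = j ∧ L = L₁ ++ L₂ :=
    ⟨L.take j, L.drop j, by simpa using hj, by simp⟩
  have := IsScalarTower.to_smulCommClass (R := K) (A := Aᵐᵒᵖ) (M := M)
  have e : (L₁ ++ X :: L₂).length = (L₁ ++ L₂).length + 1 := by simp; omega
  have e1 : (L₁ ++ L₂ ++ L₃).take L₁.length ++ X :: (L₁ ++ L₂ ++ L₃).drop L₁.length =
      (L₁ ++ X :: L₂) ++ L₃ := by simp
  have e2 : (L₁ ++ L₂ ++ L₃).take L₁.length = L₁ := by simp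
  rw [e1, e2, wedgeTerm, wedgeTerm, ← e, List.take_left, List.drop_left, List.take_left,
    List.drop_left, ins_apply, hω.move X L₁ L₂]
  simp only [List.map_append, List.map_cons, List.prod_append, List.prod_cons,
    smul_comm _ (List.prod (List.map (fun Y : HomDer ε 𝒜 => (-(ε X.1 Y.1 : K))) L₁)), smul_smul]
  congr 1
  ring

/-- Inserting `X` among the arguments of `η` moves it past the `p` arguments of `ω` and to the front
of `η`. The `p` signs combine to `(-1) ^ p`, and the factors `ε` shift the degree of `η` by `|X|`.
-/
theorem wedgeTerm_insert_right {p n : ℕ} {k l : Γ} (ω : List (HomDer ε 𝒜) → M)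
    {η : List (HomDer ε 𝒜) → A} (hη : IsForm ε 𝒜 𝒜 n k η) (X : HomDer ε 𝒜)
    (L : List (HomDer ε 𝒜)) {j : ℕ} (hj : j ≤ L.length) (hp : p ≤ j) :
    ((L.take j).map fun Y => (-(ε X.1 Y.1 : K))).prod •
        wedgeTerm p l ω η (L.take j ++ X :: L.drop j) =
      (-1 : K) ^ p • wedgeTerm p (l + X.1) ω (ins X η) L := by
  obtain ⟨L, L₃, rfl, rfl⟩ : ∃ L' L₃, L'.length = j ∧ L = L' ++ L₃ :=
    ⟨L.take j, L.drop j, by simpa using hj, by simp⟩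
  obtain ⟨L₁, L₂, rfl, rfl⟩ : ∃ L₁ L₂, L₁.length = p ∧ L = L₁ ++ L₂ :=
    ⟨L.take p, L.drop p, by simpa using hp, by simp⟩
  have e1 : ((L₁ ++ L₂) ++ L₃).drop (L₁ ++ L₂).length = L₃ := List.drop_left
  rw [e1, List.take_left, wedgeTerm, wedgeTerm, List.append_assoc, List.append_assoc,
    List.take_left, List.drop_left, List.take_left, List.drop_left, ins_apply,
    hη.move X L₂ L₃]
  have e2 : (L₁.map fun Y => (-(ε X.1 Y.1 : K))).prod * (L₁.map fun Y => (ε l Y.1 : K)).prod =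
      (-1) ^ L₁.length * (L₁.map fun Y => (ε (l + X.1) Y.1 : K)).prod := by
    clear hj hp e1
    induction L₁ with
    | nil => simp
    | cons Y L₁ ih =>
      simp only [List.map_cons, List.prod_cons, List.length_cons, pow_succ, ε.val_add_left] at ih ⊢
      linear_combination (-(ε X.1 Y.1 : K) * ε l Y.1) * ih
  simp only [List.map_append, List.prod_append, MulOpposite.op_smul, smul_assoc, smul_smul]
  rw [mul_right_comm, e2, mul_assoc]

/-- The sum over all permutations in the product formula is `p! q!` times the product. Expanding
along the position of the first argument `X`, the `p` positions among the arguments of `ω` all give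
`ε(l, |X|) (i_X ω) η`, and the `q` other ones all give `(-1) ^ p ω (i_X η)`. -/
theorem altSum_wedgeTerm {p q n : ℕ} (hn : p + q = n) {k l : Γ} {ω : List (HomDer ε 𝒜) → M}
    {η : List (HomDer ε 𝒜) → A} (hω : IsForm ε 𝒜 ℳ p k ω) (hη : IsForm ε 𝒜 𝒜 q l η)
    (Y : Fin n → HomDer ε 𝒜) :
    altSum (fun X Z => (-(ε X.1 Z.1 : K))) (wedgeTerm p l ω η) Y =
      ((p.factorial : K) * q.factorial) • wedge ((-1) ^ p) l ω η (List.ofFn Y) := by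
  induction n generalizing p q k l ω η with
  | zero =>
    obtain ⟨rfl, rfl⟩ : p = 0 ∧ q = 0 := by omega
    simp [altSum, wedgeTerm]
  | succ n ih =>
    obtain ⟨X, Y, rfl⟩ : ∃ X Y', Y = Fin.cons X Y' := ⟨Y 0, Fin.tail Y, (Fin.cons_self_tail Y).symm⟩
    have h1 : (p : K) • altSum (fun X Z => (-(ε X.1 Z.1 : K)))
        (wedgeTerm (p - 1) l (ins X ω) η) Y =
        ((p.factorial : K) * q.factorial) • wedge (-(-1) ^ p) l (ins X ω) η (List.ofFn Y) := by
      cases p with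
      | zero => simp [hω.ins_eq_zero, wedge_zero_left]
      | succ p =>
        rw [Nat.add_sub_cancel, ih (by omega) (hω.ins X) hη, smul_smul, Nat.factorial_succ,
          pow_succ, mul_neg_one, neg_neg, Nat.cast_mul, mul_assoc]
    have h2 : (q : K) • altSum (fun X Z => (-(ε X.1 Z.1 : K)))
        (wedgeTerm p (l + X.1) ω (ins X η)) Y =
        ((p.factorial : K) * q.factorial) •
          wedge ((-1) ^ p) (l + X.1) ω (ins X η) (List.ofFn Y) := by
      cases q with
      | zero => simp [hη.ins_eq_zero, wedge_zero_right]
      | succ q =>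
        rw [ih (by omega) hω (hη.ins X), smul_smul, Nat.factorial_succ, Nat.cast_mul,
          mul_left_comm]
    rw [altSum_cons, List.ofFn_cons]
    change _ = ((p.factorial : K) * q.factorial) • ins X (wedge ((-1) ^ p) l ω η) (List.ofFn Y)
    have h3 : ∀ j : Fin (n + 1), altSum (fun X Z => (-(ε X.1 Z.1 : K)))
        (fun L => ((L.take j).map fun Y => (-(ε X.1 Y.1 : K))).prod •
          wedgeTerm p l ω η (L.take j ++ X :: L.drop j)) Y =
        if (j : ℕ) < p then (ε l X.1 : K) • altSum (fun X Z => (-(ε X.1 Z.1 : K)))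
          (wedgeTerm (p - 1) l (ins X ω) η) Y
        else (-1 : K) ^ p • altSum (fun X Z => (-(ε X.1 Z.1 : K)))
          (wedgeTerm p (l + X.1) ω (ins X η)) Y := by
      intro j
      split_ifs with h
      · rw [← altSum_smul]
        refine altSum_congr _ _ fun L hL => ?_
        obtain ⟨p, rfl⟩ : ∃ p', p = p' + 1 := ⟨p - 1, by omega⟩
        exact wedgeTerm_insert_left hω η X L (by omega) (by omega)
      · rw [← altSum_smul]
        refine altSum_congr _ _ fun L hL => ?_
        exact wedgeTerm_insert_right ω hη X L (by omega) (by omega)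
    rw [Finset.sum_congr rfl fun j _ => h3 j, Finset.sum_ite, Finset.sum_const, Finset.sum_const]
    have c1 : (Finset.univ.filter fun j : Fin (n + 1) => (j : ℕ) < p).card = p := by
      rw [Fin.card_filter_val_lt]
      omega
    have c2 : (Finset.univ.filter fun j : Fin (n + 1) => ¬ (j : ℕ) < p).card = q := by
      have := Finset.card_filter_add_card_filter_not (s := (Finset.univ : Finset (Fin (n + 1))))
        (fun j => (j : ℕ) < p)
      simp only [c1, Finset.card_univ, Fintype.card_fin] at this
      omega
    rw [c1, c2, ← Nat.cast_smul_eq_nsmul K, ← Nat.cast_smul_eq_nsmul K, smul_comm _ (ε l X.1 : K),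
      smul_comm _ ((-1 : K) ^ p), h1, h2, ins_wedge, Pi.add_apply, Pi.smul_apply, Pi.smul_apply]
    module

end ProductFormula

/-! ### The differential in terms of sums over indices -/

section Differential

variable {K Γ A M : Type*} [Field K] [AddCommGroup Γ] [Ring A] [Algebra K A]
  {ε : CommutationFactor K Γ} {𝒜 : Γ → Submodule K A}

open HomDer

theorem ofFn_succAbove {α : Type*} {n : ℕ} (Y : Fin (n + 1) → α) (m : Fin (n + 1)) :
    List.ofFn (fun c => Y (m.succAbove c)) = (List.ofFn Y).eraseIdx m := by
  induction n with
  | zero =>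
    obtain rfl : m = 0 := Fin.fin_one_eq_zero m
    simp
  | succ n ih =>
    refine Fin.cases ?_ (fun m => ?_) m
    · simp [List.ofFn_succ]
    · have h := ih (fun c => Y c.succ) m
      rw [List.ofFn_succ, List.ofFn_succ (f := Y)]
      simp only [Fin.succ_succAbove_zero, Fin.succ_succAbove_succ, Fin.val_succ,
        List.eraseIdx_cons_succ]
      rw [h]

/-- The factor produced by moving `Y m` to the left of the preceding arguments. -/
def passFactor {n : ℕ} (Y : Fin n → HomDer ε 𝒜) (m : Fin n) : K :=
  ∏ a, if a < m then (ε (Y a).1 (Y m).1 : K) else 1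

theorem passFactor_cons_zero {n : ℕ} (X : HomDer ε 𝒜) (Y : Fin n → HomDer ε 𝒜) :
    passFactor (Fin.cons X Y : Fin (n + 1) → HomDer ε 𝒜) 0 = 1 := by
  simp [passFactor]

theorem passFactor_cons_succ {n : ℕ} (X : HomDer ε 𝒜) (Y : Fin n → HomDer ε 𝒜) (m : Fin n) :
    passFactor (Fin.cons X Y : Fin (n + 1) → HomDer ε 𝒜) m.succ =
      ε X.1 (Y m).1 * passFactor Y m := by
  simp [passFactor, Fin.prod_univ_succ]

theorem coe_prod_eq_passFactor {n : ℕ} (deg : Fin n → Γ) (X : ∀ m, DerHom ε 𝒜 (deg m))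
    (m : Fin n) : ((∏ a with a < m, ε (deg a) (deg m) : Kˣ) : K) =
      passFactor (fun a => (⟨deg a, X a⟩ : HomDer ε 𝒜)) m := by
  rw [Units.coe_prod, Finset.prod_filter, passFactor]

/-- The Lie derivative as an explicit sum. The bracket `[X, Y m]` stands in first position, whence
the factors produced by moving it there. -/
theorem lieD_ofFn (X : HomDer ε 𝒜) {n : ℕ} (k : Γ) (ω : List (HomDer ε 𝒜) → A)
    (hω : ∀ (L₁ L₂ : List (HomDer ε 𝒜)) (X Y : HomDer ε 𝒜),
      ω (L₁ ++ X :: Y :: L₂) = (-(ε X.1 Y.1 : K)) • ω (L₁ ++ Y :: X :: L₂))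
    (Y : Fin n → HomDer ε 𝒜) :
    lieD X k ω (List.ofFn Y) = (ε k X.1 : K) • X.map (ω (List.ofFn Y)) +
      ∑ m : Fin n, ((-1) ^ ((m : ℕ) + 1) * passFactor Y m) •
        ω (bracket X (Y m) :: (List.ofFn Y).eraseIdx m) := by
  induction n generalizing k ω with
  | zero => simp
  | succ n ih =>
    obtain ⟨Z, Y, rfl⟩ : ∃ Z Y', Y = Fin.cons Z Y' :=
      ⟨Y 0, Fin.tail Y, (Fin.cons_self_tail Y).symm⟩
    have h := ih (k + Z.1) (ins Z ω) (fun L₁ => hω (Z :: L₁)) Y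
    have h' : ∀ m : Fin n, ω (bracket X (Y m) :: Z :: (List.ofFn Y).eraseIdx m) =
        (-(ε X.1 Z.1 * ε (Y m).1 Z.1 : K)) •
          ω (Z :: bracket X (Y m) :: (List.ofFn Y).eraseIdx m) := by
      intro m
      rw [← ε.val_add_left]
      exact hω [] _ _ _
    rw [List.ofFn_cons, lieD, h, Fin.sum_univ_succ]
    simp only [Fin.cons_zero, Fin.cons_succ, passFactor_cons_zero, passFactor_cons_succ,
      Fin.val_zero, Fin.val_succ, List.eraseIdx_cons_zero, List.eraseIdx_cons_succ, h',
      ins_apply, ε.val_add_left, smul_add, Finset.smul_sum]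
    have h2 : ∀ m : Fin n, (ε X.1 Z.1 : K) • ((-1 : K) ^ ((m : ℕ) + 1) * passFactor Y m) •
        ω (Z :: bracket X (Y m) :: (List.ofFn Y).eraseIdx m) =
        ((-1 : K) ^ ((m : ℕ) + 1 + 1) * (ε Z.1 (Y m).1 * passFactor Y m)) •
          (-(ε X.1 Z.1 * ε (Y m).1 Z.1 : K)) •
          ω (Z :: bracket X (Y m) :: (List.ofFn Y).eraseIdx m) := by
      intro m
      rw [smul_smul, smul_smul]
      congr 1
      linear_combination (-(-1) ^ ((m : ℕ) + 1) * passFactor Y m * ε X.1 Z.1) *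
        ε.val_swap Z.1 (Y m).1
    rw [Finset.sum_congr rfl fun m _ => h2 m]
    linear_combination (norm := module)
      (ε.val_swap X.1 Z.1) • (ε k X.1 : K) • X.map (ω (Z :: List.ofFn Y))

/-- The differential as an explicit sum. Unfolding the recursion at the first argument, the action
of that argument and its brackets come from the Lie derivative, and the other terms from the
differential of the insertion. -/
theorem extD_ofFn {n : ℕ} (k : Γ) (ω : List (HomDer ε 𝒜) → A)
    (hω : ∀ (L₁ L₂ : List (HomDer ε 𝒜)) (X Y : HomDer ε 𝒜),
      ω (L₁ ++ X :: Y :: L₂) = (-(ε X.1 Y.1 : K)) • ω (L₁ ++ Y :: X :: L₂))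
    (Y : Fin n → HomDer ε 𝒜) :
    extD k ω (List.ofFn Y) =
      ∑ m : Fin n, ((-1) ^ (m : ℕ) * (ε k (Y m).1 * passFactor Y m)) •
        (Y m).map (ω ((List.ofFn Y).eraseIdx m)) +
      ∑ i : Fin n, ∑ m : Fin n, if m < i then
        ((-1) ^ ((m : ℕ) + (i : ℕ)) * (ε (Y i).1 (Y m).1 * passFactor Y m * passFactor Y i)) •
          ω (bracket (Y m) (Y i) :: ((List.ofFn Y).eraseIdx i).eraseIdx m) else 0 := by
  induction n generalizing k ω with
  | zero => simp
  | succ n ih =>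
    obtain ⟨X, Y, rfl⟩ : ∃ Z Y', Y = Fin.cons Z Y' :=
      ⟨Y 0, Fin.tail Y, (Fin.cons_self_tail Y).symm⟩
    have h := ih (k + X.1) (ins X ω) (fun L₁ => hω (X :: L₁)) Y
    have h' : ∀ m i : Fin n,
        ω (bracket (Y m) (Y i) :: X :: ((List.ofFn Y).eraseIdx i).eraseIdx m) =
        (-(ε (Y m).1 X.1 * ε (Y i).1 X.1 : K)) •
          ω (X :: bracket (Y m) (Y i) :: ((List.ofFn Y).eraseIdx i).eraseIdx m) := by
      intro m i
      rw [← ε.val_add_left]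
      exact hω [] _ _ _
    rw [List.ofFn_cons, extD, h, lieD_ofFn X k ω hω Y]
    simp only [Fin.sum_univ_succ, Fin.cons_zero, Fin.cons_succ, passFactor_cons_zero,
      passFactor_cons_succ, Fin.val_zero, Fin.val_succ, List.eraseIdx_cons_zero,
      List.eraseIdx_cons_succ, h', ins_apply, ε.val_add_left, Fin.not_lt_zero, if_false,
      Finset.sum_const_zero, Fin.succ_pos, if_true, Fin.succ_lt_succ_iff, zero_add, add_zero,
      pow_zero, one_mul, mul_one, Finset.sum_add_distrib]
    have h1 : ∀ m : Fin n, ((-1 : K) ^ ((m : ℕ) + 1) * (ε k (Y m).1 * (ε X.1 (Y m).1 *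
        passFactor Y m))) • (Y m).map (ω (X :: (List.ofFn Y).eraseIdx m)) =
        -(((-1 : K) ^ (m : ℕ) * (ε k (Y m).1 * ε X.1 (Y m).1 * passFactor Y m)) •
          (Y m).map (ω (X :: (List.ofFn Y).eraseIdx m))) := by
      intro m
      module
    have h2 : ∀ m : Fin n, ((-1 : K) ^ ((m : ℕ) + 1) * (ε (Y m).1 X.1 * (ε X.1 (Y m).1 *
        passFactor Y m))) • ω (bracket X (Y m) :: (List.ofFn Y).eraseIdx m) =
        ((-1 : K) ^ ((m : ℕ) + 1) * passFactor Y m) •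
          ω (bracket X (Y m) :: (List.ofFn Y).eraseIdx m) := by
      intro m
      congr 1
      linear_combination ((-1) ^ ((m : ℕ) + 1) * passFactor Y m) * ε.val_swap X.1 (Y m).1
    have h3 : ∀ i m : Fin n, (if m < i then ((-1 : K) ^ ((m : ℕ) + 1 + ((i : ℕ) + 1)) *
        (ε (Y i).1 (Y m).1 * (ε X.1 (Y m).1 * passFactor Y m) *
          (ε X.1 (Y i).1 * passFactor Y i))) • (-(ε (Y m).1 X.1 * ε (Y i).1 X.1 : K)) •
          ω (X :: bracket (Y m) (Y i) :: ((List.ofFn Y).eraseIdx i).eraseIdx m) else 0) =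
        -(if m < i then ((-1 : K) ^ ((m : ℕ) + (i : ℕ)) *
          (ε (Y i).1 (Y m).1 * passFactor Y m * passFactor Y i)) •
          ω (X :: bracket (Y m) (Y i) :: ((List.ofFn Y).eraseIdx i).eraseIdx m) else 0) := by
      intro i m
      split_ifs
      · rw [smul_smul, ← neg_smul]
        congr 1
        linear_combination (-(-1) ^ ((m : ℕ) + (i : ℕ)) *
          (ε (Y i).1 (Y m).1 * passFactor Y m * passFactor Y i)) * ε.val_swap X.1 (Y m).1 +
          (-(-1) ^ ((m : ℕ) + (i : ℕ)) * (ε X.1 (Y m).1 * ε (Y m).1 X.1) *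
          (ε (Y i).1 (Y m).1 * passFactor Y m * passFactor Y i)) * ε.val_swap X.1 (Y i).1
      · simp
    simp only [h1, h2, h3, Finset.sum_neg_distrib]
    abel

end Differential

section Total

variable {K Γ A M : Type*} [Field K] [AddCommGroup Γ] [Ring A] [Algebra K A]
  {ε : CommutationFactor K Γ} {𝒜 : Γ → Submodule K A}

/-! ### Comparison with the explicit formulas -/

section Formulas

variable [SetLike.GradedMul 𝒜]

/-- The sign of a permutation is distributed over its inversions, which turns the sum of the product
formula into `altSum`. -/
theorem productFormula_eq_wedge [CharZero K] [AddCommGroup M] [Module K M] [Module Aᵐᵒᵖ M]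
    [IsScalarTower K Aᵐᵒᵖ M] {ℳ : Γ → Submodule K M} {p q : ℕ} {k l : Γ}
    (ω : Forms ε 𝒜 ℳ p k) (η : Forms ε 𝒜 𝒜 q l) (deg : Fin (p + q) → Γ)
    (X : ∀ m, DerHom ε 𝒜 (deg m)) :
    productFormula ω η deg X = wedge ((-1) ^ p) l (formVal ω) (formVal η)
      (List.ofFn fun m => (⟨deg m, X m⟩ : HomDer ε 𝒜)) := by
  have hfac : (p.factorial : K) * q.factorial ≠ 0 :=
    mul_ne_zero (Nat.cast_ne_zero.2 p.factorial_ne_zero) (Nat.cast_ne_zero.2 q.factorial_ne_zero)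
  rw [productFormula, inv_smul_eq_iff₀ hfac,
    ← altSum_wedgeTerm rfl (isForm_formVal ω) (isForm_formVal η), altSum]
  refine Finset.sum_congr rfl fun σ _ => ?_
  have hsplit : List.ofFn ((fun m => (⟨deg m, X m⟩ : HomDer ε 𝒜)) ∘ σ) =
      (List.ofFn fun m : Fin p => (⟨deg (σ (m.castAdd q)), X (σ (m.castAdd q))⟩ : HomDer ε 𝒜)) ++
      List.ofFn fun m : Fin q => (⟨deg (σ (m.natAdd p)), X (σ (m.natAdd p))⟩ : HomDer ε 𝒜) :=
    List.ofFn_add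
  have htake : (List.ofFn ((fun m => (⟨deg m, X m⟩ : HomDer ε 𝒜)) ∘ σ)).take p =
      List.ofFn fun m : Fin p => (⟨deg (σ (m.castAdd q)), X (σ (m.castAdd q))⟩ : HomDer ε 𝒜) := by
    rw [hsplit]
    exact List.take_left' (by simp)
  have hdrop : (List.ofFn ((fun m => (⟨deg m, X m⟩ : HomDer ε 𝒜)) ∘ σ)).drop p =
      List.ofFn fun m : Fin q => (⟨deg (σ (m.natAdd p)), X (σ (m.natAdd p))⟩ : HomDer ε 𝒜) := by
    rw [hsplit]
    exact List.drop_left' (by simp)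
  have hsign : ((Equiv.Perm.sign σ : ℤ) : K) *
      ((∏ x : Fin (p + q) × Fin (p + q) with x.1 < x.2 ∧ σ x.2 < σ x.1,
          ε (deg (σ x.2)) (deg (σ x.1)) : Kˣ) : K) =
      ∏ b, ∏ a, if a < b then
        (if σ a < σ b then 1 else (-(ε (deg (σ b)) (deg (σ a)) : K))) else 1 := by
    rw [Equiv.Perm.sign_eq_prod_prod_Iio, Finset.prod_filter, Fintype.prod_prod_type,
      Finset.prod_comm, Units.coe_prod, Int.cast_prod, Units.coe_prod, ← Finset.prod_mul_distrib]
    refine Finset.prod_congr rfl fun b _ => ?_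
    rw [Units.coe_prod, Int.cast_prod, Units.coe_prod, ← Finset.filter_gt_eq_Iio,
      Finset.prod_filter, ← Finset.prod_mul_distrib]
    refine Finset.prod_congr rfl fun a _ => ?_
    by_cases hab : a < b
    · rcases lt_trichotomy (σ a) (σ b) with h | h | h
      · simp [hab, h, h.not_gt]
      · exact absurd (σ.injective h) hab.ne
      · simp [hab, h, h.not_gt]
    · simp [hab]
  rw [wedgeTerm, htake, hdrop, formVal_ofFn, formVal_ofFn, smul_smul, hsign, List.map_ofFn,
    List.prod_ofFn, Units.coe_prod]
  rfl

theorem diffSum_eq_extD {p : ℕ} {k : Γ} (ω : Forms ε 𝒜 𝒜 p k) (deg : Fin (p + 1) → Γ)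
    (X : ∀ m, DerHom ε 𝒜 (deg m)) :
    diffActionSum ω deg X + diffBracketSum ω deg X = extD k (formVal ω)
      (List.ofFn fun m => (⟨deg m, X m⟩ : HomDer ε 𝒜)) := by
  rw [extD_ofFn k _ (isForm_formVal ω).anti]
  congr 1
  · rw [diffActionSum]
    refine Finset.sum_congr rfl fun m _ => ?_
    rw [← ofFn_succAbove, formVal_ofFn, Units.val_mul, coe_prod_eq_passFactor deg X]
    rfl
  · cases p with
    | zero => simp [diffBracketSum, Fin.fin_one_eq_zero]
    | succ r =>
      rw [diffBracketSum]
      refine Finset.sum_congr rfl fun i _ => ?_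
      rw [Finset.sum_filter]
      conv_rhs => rw [Fin.sum_univ_castSucc, if_neg (Fin.le_last i).not_gt, add_zero]
      refine Finset.sum_congr rfl fun m _ => ?_
      split_ifs with h
      · rw [Units.val_mul, Units.val_mul, coe_prod_eq_passFactor deg X,
          coe_prod_eq_passFactor deg X, ← ofFn_succAbove, Fin.val_castSucc,
          ← ofFn_succAbove (fun c => (⟨deg (i.succAbove c), X (i.succAbove c)⟩ : HomDer ε 𝒜)) m,
          ← List.ofFn_cons, formVal_ofFn]
        congr 2
        funext c
        refine Fin.cases ?_ (fun c => ?_) c <;> simp <;> rfl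
      · rfl

end Formulas

/-! ### The total space -/

variable [DecidableEq Γ] [GradedAlgebra 𝒜]
  [AddCommGroup M] [Module K M] [Module Aᵐᵒᵖ M] [IsScalarTower K Aᵐᵒᵖ M]
  {ℳ : Γ → Submodule K M}

theorem omega_induction {P : Omega ε 𝒜 ℳ → Prop} (v : Omega ε 𝒜 ℳ)
    (h : ∀ (n : ℕ) (k : Γ) (ω : Forms ε 𝒜 ℳ n k), P (toOmega ω))
    (hadd : ∀ v w, P v → P w → P (v + w)) : P v := by
  induction v using DirectSum.induction_on with
  | zero => simpa using h 0 0 0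
  | of x ω => exact h x.1 x.2 ω
  | add v w hv hw => exact hadd v w hv hw

theorem omega_hom_ext {N : Type*} [AddCommMonoid N] [Module K N] {f g : Omega ε 𝒜 ℳ →ₗ[K] N}
    (h : ∀ (n : ℕ) (k : Γ) (ω : Forms ε 𝒜 ℳ n k), f (toOmega ω) = g (toOmega ω)) : f = g :=
  LinearMap.ext fun v => omega_induction (P := fun v => f v = g v) v h fun v w hv hw => by
    rw [map_add, map_add, hv, hw]

/-- Forms whose degrees are equal, but not definitionally so, are compared through their values. -/
theorem toOmega_congr {n n' : ℕ} {k k' : Γ} {θ : Forms ε 𝒜 ℳ n k} {θ' : Forms ε 𝒜 ℳ n' k'}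
    (hn : n = n') (hk : k = k') (h : formVal θ = formVal θ') : toOmega θ = toOmega θ' := by
  subst hn hk
  rw [formVal_injective h]

theorem exists_toOmega_eq {n n' : ℕ} {k k' : Γ} (θ : Forms ε 𝒜 ℳ n k) (hn : n = n')
    (hk : k = k') : ∃ θ' : Forms ε 𝒜 ℳ n' k', toOmega θ = toOmega θ' ∧ formVal θ' = formVal θ := by
  subst hn hk
  exact ⟨θ, rfl, rfl⟩

theorem omegaGrading_natCast (n : ℕ) (k : Γ) : omegaGrading ε 𝒜 ℳ ((n : ℤ), k) =
    LinearMap.range (toOmega : Forms ε 𝒜 ℳ n k →ₗ[K] Omega ε 𝒜 ℳ) := by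
  refine le_antisymm (iSup₂_le fun n' h => ?_) ?_
  · obtain rfl : n' = n := by simpa using h
    exact le_rfl
  · exact le_iSup₂_of_le (f := fun (n' : ℕ) (_ : (n' : ℤ) = n) =>
      LinearMap.range (toOmega : Forms ε 𝒜 ℳ n' k →ₗ[K] Omega ε 𝒜 ℳ)) n rfl le_rfl

theorem toOmega_mem {n : ℕ} {k : Γ} (ω : Forms ε 𝒜 ℳ n k) {x : ℤ × Γ} (hn : (n : ℤ) = x.1)
    (hk : k = x.2) : toOmega ω ∈ omegaGrading ε 𝒜 ℳ x := by
  obtain ⟨i, j⟩ := x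
  subst hn hk
  rw [omegaGrading_natCast]
  exact ⟨ω, rfl⟩

/-- A homogeneous element of `Ω(A, M)` is zero or a form; the first case covers the negative
`ℤ`-degrees. -/
theorem eq_zero_or_exists_toOmega {x : ℤ × Γ} {v : Omega ε 𝒜 ℳ}
    (hv : v ∈ omegaGrading ε 𝒜 ℳ x) :
    v = 0 ∨ ∃ (n : ℕ) (k : Γ) (ω : Forms ε 𝒜 ℳ n k), x = ((n : ℤ), k) ∧ v = toOmega ω := by
  obtain ⟨i, k⟩ := x
  obtain ⟨n, rfl | rfl⟩ := i.eq_nat_or_neg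
  · rw [omegaGrading_natCast] at hv
    obtain ⟨ω, rfl⟩ := hv
    exact .inr ⟨n, k, ω, rfl, rfl⟩
  · rcases n with _ | n
    · rw [Nat.cast_zero, neg_zero, ← Nat.cast_zero, omegaGrading_natCast] at hv
      obtain ⟨ω, rfl⟩ := hv
      exact .inr ⟨0, k, ω, rfl, rfl⟩
    · left
      have h : omegaGrading ε 𝒜 ℳ (-((n + 1 : ℕ) : ℤ), k) = ⊥ := by
        refine le_bot_iff.1 (iSup₂_le fun m hm => ?_)
        exfalso
        simp only at hm
        omega
      rwa [h, Submodule.mem_bot] at hv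

/-- A criterion for internality where the additive commutative monoid structure is not literally the
one which underlies the group structure. -/
theorem isInternal_of_addCommGroup {R V ι : Type*} [Ring R] [DecidableEq ι] [a : AddCommMonoid V]
    [Module R V] (b : AddCommGroup V) (h : b.toAddCommMonoid = a) (𝒱 : ι → Submodule R V)
    (h1 : iSupIndep 𝒱) (h2 : iSup 𝒱 = ⊤) : DirectSum.IsInternal 𝒱 := by
  subst h
  exact DirectSum.isInternal_submodule_of_iSupIndep_of_iSup_eq_top h1 h2

theorem omegaGrading_isInternal : DirectSum.IsInternal (omegaGrading ε 𝒜 ℳ) := by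
  refine isInternal_of_addCommGroup DirectSum.instAddCommGroup rfl (omegaGrading ε 𝒜 ℳ) ?_ ?_
  · intro x
    rw [Submodule.disjoint_def]
    intro v hv hv'
    rcases eq_zero_or_exists_toOmega hv with h | ⟨n, k, ω, rfl, rfl⟩
    · exact h
    have hle : ⨆ (y) (_ : y ≠ ((n : ℤ), k)), omegaGrading ε 𝒜 ℳ y ≤
        LinearMap.ker (DirectSum.component K (ℕ × Γ) (fun x => Forms ε 𝒜 ℳ x.1 x.2) (n, k)) := by
      refine iSup₂_le fun y hy w hw => ?_
      rcases eq_zero_or_exists_toOmega hw with rfl | ⟨n', k', ω', rfl, rfl⟩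
      · exact zero_mem _
      · rw [LinearMap.mem_ker, toOmega, DirectSum.component.of, dif_neg]
        rintro h
        apply hy
        simp only [Prod.mk.injEq] at h ⊢
        exact ⟨by exact_mod_cast h.1, h.2⟩
    have h := hle hv'
    rw [LinearMap.mem_ker, toOmega, DirectSum.component.lof_self] at h
    rw [h, map_zero]
  · rw [eq_top_iff]
    intro v _
    refine omega_induction v (fun n k ω => ?_) fun v w hv hw => add_mem hv hw
    exact Submodule.mem_iSup_of_mem ((n : ℤ), k) (toOmega_mem ω rfl rfl)

/-- The unit, seen as a function of lists. -/
theorem formVal_one : ∃ θ : Forms ε 𝒜 𝒜 0 0, omegaOne ε 𝒜 = toOmega θ ∧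
    formVal θ = fun L => if L = [] then 1 else 0 := by
  refine ⟨_, rfl, funext fun L => ?_⟩
  cases L with
  | nil => exact (dif_pos rfl).trans (if_pos rfl).symm
  | cons X L => rw [formVal, dif_neg (by simp), if_neg (by simp)]

end Total

/-! ### The product and the differential on the total space -/

/-- The Leibniz rule may be checked on nonzero homogeneous elements. Its three terms may be given as
images under a linear map `f`, so that the identity itself is proved in the source of `f`; below,
this is a single space of forms. -/
theorem mem_epsDerivations_of_generators {K G V : Type*} [Field K] [AddCommGroup G]
    [DecidableEq G] [AddCommMonoid V] [Module K V] {δ : CommutationFactor K G}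
    {𝒱 : G → Submodule K V} {mul : V →ₗ[K] V →ₗ[K] V} {i : G} {d : V →ₗ[K] V}
    (h𝒱 : DirectSum.IsInternal 𝒱) (hd : ∀ j, ∀ a ∈ 𝒱 j, a ≠ 0 → d a ∈ 𝒱 (i + j))
    (hmul : ∀ j, ∀ a ∈ 𝒱 j, a ≠ 0 → ∀ k, ∀ b ∈ 𝒱 k, b ≠ 0 →
      ∃ (F : Type u₁) (_ : AddCommMonoid F) (_ : Module K F) (f : F →ₗ[K] V) (x y z : F),
        d (mul a b) = f x ∧ mul (d a) b = f y ∧ mul a (d b) = f z ∧ x = y + (δ i j : K) • z) :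
    d ∈ EpsDerivations δ 𝒱 mul i := by
  refine ⟨fun j a ha => ?_, fun j a ha b => ?_⟩
  · by_cases h : a = 0
    · simp [h]
    · exact hd j a ha h
  · have hb : b ∈ ⨆ k, 𝒱 k := by
      rw [h𝒱.submodule_iSup_eq_top]
      trivial
    induction hb using Submodule.iSup_induction' with
    | mem k b hb =>
      by_cases ha0 : a = 0
      · simp [ha0]
      by_cases hb0 : b = 0
      · simp [hb0]
      obtain ⟨F, _, _, f, x, y, z, h1, h2, h3, h4⟩ := hmul j a ha ha0 k b hb hb0
      rw [h1, h2, h3, h4, map_add, map_smul]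
    | zero => simp
    | add b c _ _ hb hc =>
      rw [map_add, map_add, hb, hc, map_add, map_add, map_add, smul_add]
      abel

section Existence

variable {K Γ A M : Type*} [Field K] [AddCommGroup Γ] [DecidableEq Γ] [Ring A] [Algebra K A]
  {ε : CommutationFactor K Γ} {𝒜 : Γ → Submodule K A} [GradedAlgebra 𝒜]
  [AddCommGroup M] [Module K M] [Module Aᵐᵒᵖ M] [IsScalarTower K Aᵐᵒᵖ M]
  {ℳ : Γ → Submodule K M}

theorem smul_mem_graded (i j : Γ) (a : A) (ha : a ∈ 𝒜 i) (b : A) (hb : b ∈ 𝒜 j) :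
    a <• b ∈ 𝒜 (i + j) := by
  rw [op_smul_eq_mul]
  exact SetLike.mul_mem_graded ha hb

/-- The form which corresponds to a function of lists. -/
noncomputable def formOf {n : ℕ} {k : Γ} {f : List (HomDer ε 𝒜) → M}
    (hf : IsForm ε 𝒜 ℳ n k f) : Forms ε 𝒜 ℳ n k :=
  (exists_formVal_eq hf).choose

theorem formVal_formOf {n : ℕ} {k : Γ} {f : List (HomDer ε 𝒜) → M}
    (hf : IsForm ε 𝒜 ℳ n k f) : formVal (formOf hf) = f :=
  (exists_formVal_eq hf).choose_spec

/-- The product of two forms, as a bilinear map. -/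
noncomputable def wedgeForms (hℳ : ∀ i j, ∀ m ∈ ℳ i, ∀ a ∈ 𝒜 j, m <• a ∈ ℳ (i + j))
    (p q : ℕ) (k l : Γ) :
    Forms ε 𝒜 ℳ p k →ₗ[K] Forms ε 𝒜 𝒜 q l →ₗ[K] Forms ε 𝒜 ℳ (p + q) (k + l) :=
  LinearMap.mk₂ K
    (fun ω η => formOf (isForm_wedge hℳ ((-1) ^ p) (isForm_formVal ω) (isForm_formVal η)))
    (fun ω ω' η => formVal_injective (by
      simp only [formVal_formOf, formVal_add, wedge_add_left]))
    (fun c ω η => formVal_injective (by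
      simp only [formVal_formOf, formVal_smul, wedge_smul_left]))
    (fun ω η η' => formVal_injective (by
      simp only [formVal_formOf, formVal_add, wedge_add_right]))
    (fun c ω η => formVal_injective (by
      simp only [formVal_formOf, formVal_smul, wedge_smul_right]))

theorem formVal_wedgeForms (hℳ : ∀ i j, ∀ m ∈ ℳ i, ∀ a ∈ 𝒜 j, m <• a ∈ ℳ (i + j))
    {p q : ℕ} {k l : Γ} (ω : Forms ε 𝒜 ℳ p k) (η : Forms ε 𝒜 𝒜 q l) :
    formVal (wedgeForms hℳ p q k l ω η) = wedge ((-1) ^ p) l (formVal ω) (formVal η) :=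
  formVal_formOf (isForm_wedge hℳ ((-1) ^ p) (isForm_formVal ω) (isForm_formVal η))

/-- The differential of forms, as a linear map. -/
noncomputable def extForms (p : ℕ) (k : Γ) :
    Forms ε 𝒜 𝒜 p k →ₗ[K] Forms ε 𝒜 𝒜 (p + 1) k where
  toFun ω := formOf (isForm_extD (isForm_formVal ω))
  map_add' ω η := formVal_injective (by simp only [formVal_formOf, formVal_add, extD_add])
  map_smul' c ω := formVal_injective (by
    simp only [formVal_formOf, formVal_smul, extD_smul, RingHom.id_apply])

theorem formVal_extForms {p : ℕ} {k : Γ} (ω : Forms ε 𝒜 𝒜 p k) :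
    formVal (extForms p k ω) = extD k (formVal ω) :=
  formVal_formOf (isForm_extD (isForm_formVal ω))

/-- A form which takes the values of `f` on tuples is given by the function `f` of lists. -/
theorem formVal_eq_of_ofFn {n : ℕ} {k : Γ} {θ : Forms ε 𝒜 ℳ n k} {f : List (HomDer ε 𝒜) → M}
    (hf : IsForm ε 𝒜 ℳ n k f)
    (h : ∀ (deg : Fin n → Γ) (X : ∀ m, DerHom ε 𝒜 (deg m)),
      θ.1 (fun m => toDer (X m)) = f (List.ofFn fun m => ⟨deg m, X m⟩)) : formVal θ = f := by
  funext L
  by_cases hL : L.length = n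
  · obtain ⟨Y, rfl⟩ := exists_ofFn_eq L hL
    rw [formVal_ofFn]
    exact h (fun m => (Y m).1) fun m => (Y m).2
  · rw [hf.supp L hL, (isForm_formVal θ).supp L hL]

/-- The defining formula characterizes the bilinear maps which extend `wedgeForms`. -/
theorem isFormProduct_iff [CharZero K]
    (hℳ : ∀ i j, ∀ m ∈ ℳ i, ∀ a ∈ 𝒜 j, m <• a ∈ ℳ (i + j))
    (act : Omega ε 𝒜 ℳ →ₗ[K] Omega ε 𝒜 𝒜 →ₗ[K] Omega ε 𝒜 ℳ) :
    IsFormProduct ε 𝒜 ℳ act ↔ ∀ (p q : ℕ) (k l : Γ) (ω : Forms ε 𝒜 ℳ p k)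
      (η : Forms ε 𝒜 𝒜 q l), act (toOmega ω) (toOmega η) = toOmega (wedgeForms hℳ p q k l ω η) := by
  refine forall₄_congr fun p q k l => forall₂_congr fun ω η => ⟨?_, fun h => ⟨_, h, ?_⟩⟩
  · rintro ⟨θ, h, hθ⟩
    rw [h]
    refine toOmega_congr rfl rfl ?_
    rw [formVal_wedgeForms]
    exact formVal_eq_of_ofFn (isForm_wedge hℳ _ (isForm_formVal ω) (isForm_formVal η))
      fun deg X => by rw [hθ, productFormula_eq_wedge]
  · intro deg X
    rw [productFormula_eq_wedge, ← formVal_wedgeForms hℳ, formVal_ofFn]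
    rfl

/-- The defining formula characterizes the linear maps which extend `extForms`. -/
theorem isFormDifferential_iff (d : Omega ε 𝒜 𝒜 →ₗ[K] Omega ε 𝒜 𝒜) :
    IsFormDifferential ε 𝒜 d ↔ ∀ (p : ℕ) (k : Γ) (ω : Forms ε 𝒜 𝒜 p k),
      d (toOmega ω) = toOmega (extForms p k ω) := by
  refine forall₃_congr fun p k ω => ⟨?_, fun h => ⟨_, h, ?_⟩⟩
  · rintro ⟨θ, h, hθ⟩
    rw [h]
    refine toOmega_congr rfl rfl ?_
    rw [formVal_extForms]
    exact formVal_eq_of_ofFn (isForm_extD (isForm_formVal ω))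
      fun deg X => by rw [hθ, diffSum_eq_extD]
  · intro deg X
    rw [diffSum_eq_extD, ← formVal_extForms, formVal_ofFn]
    rfl

theorem existsUnique_isFormProduct [CharZero K]
    (hℳ : ∀ i j, ∀ m ∈ ℳ i, ∀ a ∈ 𝒜 j, m <• a ∈ ℳ (i + j)) :
    ∃! act : Omega ε 𝒜 ℳ →ₗ[K] Omega ε 𝒜 𝒜 →ₗ[K] Omega ε 𝒜 ℳ, IsFormProduct ε 𝒜 ℳ act := by
  simp only [isFormProduct_iff hℳ]
  refine ⟨DirectSum.toModule K (ℕ × Γ) _ fun x => (DirectSum.toModule K (ℕ × Γ) _ fun y =>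
    ((wedgeForms hℳ x.1 y.1 x.2 y.2).compr₂ toOmega).flip).flip, fun p q k l ω η => ?_,
    fun act h => ?_⟩
  · simp only [toOmega]
    rw [DirectSum.toModule_lof, LinearMap.flip_apply, DirectSum.toModule_lof]
    rfl
  · refine omega_hom_ext fun p k ω => omega_hom_ext fun q l η => ?_
    rw [h]
    simp only [toOmega]
    rw [DirectSum.toModule_lof, LinearMap.flip_apply, DirectSum.toModule_lof]
    rfl

theorem existsUnique_isFormDifferential :
    ∃! d : Omega ε 𝒜 𝒜 →ₗ[K] Omega ε 𝒜 𝒜, IsFormDifferential ε 𝒜 d := by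
  simp only [isFormDifferential_iff]
  refine ⟨DirectSum.toModule K (ℕ × Γ) _ fun x => toOmega ∘ₗ extForms x.1 x.2,
    fun p k ω => ?_, fun d h => omega_hom_ext fun p k ω => ?_⟩
  · simp only [toOmega]
    rw [DirectSum.toModule_lof]
    rfl
  · rw [h]
    simp only [toOmega]
    rw [DirectSum.toModule_lof]
    rfl

variable {mul : Omega ε 𝒜 𝒜 →ₗ[K] Omega ε 𝒜 𝒜 →ₗ[K] Omega ε 𝒜 𝒜}
  {act : Omega ε 𝒜 ℳ →ₗ[K] Omega ε 𝒜 𝒜 →ₗ[K] Omega ε 𝒜 ℳ}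
  {d : Omega ε 𝒜 𝒜 →ₗ[K] Omega ε 𝒜 𝒜}

theorem act_act_of_isFormProduct [CharZero K]
    (hℳ : ∀ i j, ∀ m ∈ ℳ i, ∀ a ∈ 𝒜 j, m <• a ∈ ℳ (i + j))
    (hmul : IsFormProduct ε 𝒜 𝒜 mul) (hact : IsFormProduct ε 𝒜 ℳ act)
    (w : Omega ε 𝒜 ℳ) (a b : Omega ε 𝒜 𝒜) : act (act w a) b = act w (mul a b) := by
  rw [isFormProduct_iff smul_mem_graded] at hmul
  rw [isFormProduct_iff hℳ] at hact
  refine omega_induction (P := fun w => act (act w a) b = act w (mul a b)) w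
    (fun p k ω => ?_) fun v w hv hw => by simp only [map_add, LinearMap.add_apply, hv, hw]
  refine omega_induction (P := fun a => act (act (toOmega ω) a) b = act (toOmega ω) (mul a b)) a
    (fun q l η => ?_) fun v w hv hw => by simp only [map_add, LinearMap.add_apply, hv, hw]
  refine omega_induction (P := fun b => act (act (toOmega ω) (toOmega η)) b =
    act (toOmega ω) (mul (toOmega η) b)) b
    (fun r m ζ => ?_) fun v w hv hw => by simp only [map_add, hv, hw]
  rw [hact p q k l ω η, hact _ _ _ _ (wedgeForms hℳ p q k l ω η) ζ, hmul q r l m η ζ,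
    hact _ _ _ _ ω (wedgeForms smul_mem_graded q r l m η ζ)]
  refine toOmega_congr (add_assoc _ _ _) (add_assoc _ _ _) ?_
  simp only [formVal_wedgeForms]
  rw [pow_add, wedge_assoc]

theorem act_one_of_isFormProduct [CharZero K]
    (hℳ : ∀ i j, ∀ m ∈ ℳ i, ∀ a ∈ 𝒜 j, m <• a ∈ ℳ (i + j))
    (hact : IsFormProduct ε 𝒜 ℳ act) (w : Omega ε 𝒜 ℳ) : act w (omegaOne ε 𝒜) = w := by
  rw [isFormProduct_iff hℳ] at hact
  obtain ⟨θ, h1, hθ⟩ := formVal_one (ε := ε) (𝒜 := 𝒜)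
  rw [h1]
  refine omega_induction (P := fun w => act w (toOmega θ) = w) w
    (fun p k ω => ?_) fun v w hv hw => by simp only [map_add, LinearMap.add_apply, hv, hw]
  rw [hact p 0 k 0 ω θ]
  refine toOmega_congr (add_zero _) (add_zero _) ?_
  rw [formVal_wedgeForms, hθ, wedge_one]

theorem act_mem_of_isFormProduct [CharZero K]
    (hℳ : ∀ i j, ∀ m ∈ ℳ i, ∀ a ∈ 𝒜 j, m <• a ∈ ℳ (i + j))
    (hact : IsFormProduct ε 𝒜 ℳ act) (x y : ℤ × Γ) {w : Omega ε 𝒜 ℳ}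
    (hw : w ∈ omegaGrading ε 𝒜 ℳ x) {a : Omega ε 𝒜 𝒜} (ha : a ∈ omegaGrading ε 𝒜 𝒜 y) :
    act w a ∈ omegaGrading ε 𝒜 ℳ (x + y) := by
  rw [isFormProduct_iff hℳ] at hact
  rcases eq_zero_or_exists_toOmega hw with rfl | ⟨p, k, ω, rfl, rfl⟩
  · rw [map_zero, LinearMap.zero_apply]
    exact zero_mem _
  rcases eq_zero_or_exists_toOmega ha with rfl | ⟨q, l, η, rfl, rfl⟩
  · rw [map_zero]
    exact zero_mem _
  rw [hact p q k l ω η]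
  exact toOmega_mem _ (by simp) rfl

theorem isGradedRightModuleAction_of_isFormProduct [CharZero K]
    (hℳ : ∀ i j, ∀ m ∈ ℳ i, ∀ a ∈ 𝒜 j, m <• a ∈ ℳ (i + j))
    (hmul : IsFormProduct ε 𝒜 𝒜 mul) (hact : IsFormProduct ε 𝒜 ℳ act) :
    IsGradedRightModuleAction (omegaGrading ε 𝒜 𝒜) mul (omegaOne ε 𝒜)
      (omegaGrading ε 𝒜 ℳ) act where
  isInternal := omegaGrading_isInternal
  act_act := act_act_of_isFormProduct hℳ hmul hact
  act_one := act_one_of_isFormProduct hℳ hact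
  act_mem x y _ hw _ ha := act_mem_of_isFormProduct hℳ hact x y hw ha

theorem isGradedAlgebraProduct_of_isFormProduct [CharZero K] (hmul : IsFormProduct ε 𝒜 𝒜 mul) :
    IsGradedAlgebraProduct (omegaGrading ε 𝒜 𝒜) mul (omegaOne ε 𝒜) := by
  have h := isGradedRightModuleAction_of_isFormProduct smul_mem_graded hmul hmul
  refine ⟨h.isInternal, h.act_act, fun a => ?_, h.act_one, ?_, h.act_mem⟩
  · rw [isFormProduct_iff smul_mem_graded] at hmul
    obtain ⟨θ, h1, hθ⟩ := formVal_one (ε := ε) (𝒜 := 𝒜)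
    rw [h1]
    refine omega_induction (P := fun a => mul (toOmega θ) a = a) a
      (fun p k ω => ?_) fun v w hv hw => by simp only [map_add, hv, hw]
    rw [hmul]
    refine toOmega_congr (zero_add _) (zero_add _) ?_
    rw [formVal_wedgeForms, hθ, pow_zero, one_wedge]
  · obtain ⟨θ, h1, -⟩ := formVal_one (ε := ε) (𝒜 := 𝒜)
    rw [h1]
    exact toOmega_mem θ rfl rfl

-- Unifying the terms in `Omega` unfolds its module structure, which is slow.
set_option maxHeartbeats 2000000 in
/-- The Leibniz rule for forms. The two terms on the right have form degrees `p + 1 + q` and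
`p + (q + 1)`, so they are first identified in `Ω(A)` with forms of degree `p + q + 1`. -/
theorem exists_extForms_wedgeForms [CharZero K] {p q : ℕ} {k l : Γ} (ω : Forms ε 𝒜 𝒜 p k)
    (η : Forms ε 𝒜 𝒜 q l) :
    ∃ θ θ' : Forms ε 𝒜 𝒜 (p + q + 1) (k + l),
      toOmega (wedgeForms smul_mem_graded (p + 1) q k l (extForms p k ω) η) = toOmega θ ∧
      toOmega (wedgeForms smul_mem_graded p (q + 1) k l ω (extForms q l η)) = toOmega θ' ∧
      extForms _ _ (wedgeForms smul_mem_graded p q k l ω η) = θ + (-1 : K) ^ p • θ' := by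
  obtain ⟨θ, h1, h2⟩ := exists_toOmega_eq
    (wedgeForms smul_mem_graded (p + 1) q k l (extForms p k ω) η) (add_right_comm p 1 q) rfl
  obtain ⟨θ', h1', h2'⟩ := exists_toOmega_eq
    (wedgeForms smul_mem_graded p (q + 1) k l ω (extForms q l η)) (add_assoc p q 1).symm rfl
  refine ⟨θ, θ', h1, h1', formVal_injective ?_⟩
  rw [formVal_add, formVal_smul, h2, h2']
  simp only [formVal_wedgeForms, formVal_extForms]
  rw [extD_wedge _ (by rw [← mul_pow]; simp) (isForm_formVal ω).mem, pow_succ, mul_neg_one]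

-- Unifying the terms in `Omega` unfolds its module structure, which is slow.
set_option maxHeartbeats 2000000 in
theorem isFormDifferential_mem_epsDerivations [CharZero K] (hmul : IsFormProduct ε 𝒜 𝒜 mul)
    (hd : IsFormDifferential ε 𝒜 d) :
    d ∈ EpsDerivations ε.tilde (omegaGrading ε 𝒜 𝒜) mul (1, 0) := by
  rw [isFormProduct_iff smul_mem_graded] at hmul
  rw [isFormDifferential_iff] at hd
  refine mem_epsDerivations_of_generators omegaGrading_isInternal (fun x a ha ha0 => ?_)
    fun x a ha ha0 y b hb hb0 => ?_
  · obtain ⟨p, k, ω, rfl, rfl⟩ := (eq_zero_or_exists_toOmega ha).resolve_left ha0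
    rw [hd p k ω]
    exact toOmega_mem _ (by simp [add_comm]) (by simp)
  · obtain ⟨p, k, ω, rfl, rfl⟩ := (eq_zero_or_exists_toOmega ha).resolve_left ha0
    obtain ⟨q, l, η, rfl, rfl⟩ := (eq_zero_or_exists_toOmega hb).resolve_left hb0
    obtain ⟨θ, θ', h1, h2, h3⟩ := exists_extForms_wedgeForms ω η
    refine ⟨_, _, _, toOmega, extForms _ _ (wedgeForms smul_mem_graded p q k l ω η), θ, θ',
      ?_, ?_, ?_, ?_⟩
    · rw [hmul p q k l ω η, hd _ _ (wedgeForms smul_mem_graded p q k l ω η)]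
    · rw [hd p k ω, hmul _ _ _ _ (extForms p k ω) η, h1]
    · rw [hd q l η, hmul _ _ _ _ ω (extForms q l η), h2]
    · rw [ε.val_tilde_one_zero, h3]

theorem isFormDifferential_comp_self (hd : IsFormDifferential ε 𝒜 d) : d ∘ₗ d = 0 := by
  rw [isFormDifferential_iff] at hd
  refine omega_hom_ext fun p k ω => ?_
  rw [LinearMap.comp_apply, hd, hd, LinearMap.zero_apply,
    ← map_zero (toOmega : Forms ε 𝒜 𝒜 (p + 1 + 1) k →ₗ[K] _)]
  refine toOmega_congr rfl rfl ?_
  rw [formVal_extForms, formVal_extForms, extD_extD (isForm_formVal ω)]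
  simpa using (formVal_smul 0 (0 : Forms ε 𝒜 𝒜 (p + 1 + 1) k)).symm

end Existence

theorem mainTheorem1 {K : Type u₁} {Γ : Type u₂} {A : Type u₃} [Field K] [CharZero K]
    [AddCommGroup Γ] [DecidableEq Γ] [Ring A] [Algebra K A]
    (ε : CommutationFactor K Γ) (𝒜 : Γ → Submodule K A) [GradedAlgebra 𝒜] :
    (∃! mul : Omega ε 𝒜 𝒜 →ₗ[K] Omega ε 𝒜 𝒜 →ₗ[K] Omega ε 𝒜 𝒜, IsFormProduct ε 𝒜 𝒜 mul) ∧
    (∃! d : Omega ε 𝒜 𝒜 →ₗ[K] Omega ε 𝒜 𝒜, IsFormDifferential ε 𝒜 d) ∧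
    ∀ (mul : Omega ε 𝒜 𝒜 →ₗ[K] Omega ε 𝒜 𝒜 →ₗ[K] Omega ε 𝒜 𝒜)
      (d : Omega ε 𝒜 𝒜 →ₗ[K] Omega ε 𝒜 𝒜),
      IsFormProduct ε 𝒜 𝒜 mul → IsFormDifferential ε 𝒜 d →
      IsGradedAlgebraProduct (omegaGrading ε 𝒜 𝒜) mul (omegaOne ε 𝒜) ∧
      d ∈ EpsDerivations ε.tilde (omegaGrading ε 𝒜 𝒜) mul (1, 0) ∧
      d ∘ₗ d = 0 ∧
      ∀ (M : Type u₄) [AddCommGroup M] [Module K M] [Module Aᵐᵒᵖ M] [IsScalarTower K Aᵐᵒᵖ M]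
        (ℳ : Γ → Submodule K M),
        DirectSum.IsInternal ℳ →
        (∀ i j, ∀ m ∈ ℳ i, ∀ a ∈ 𝒜 j, m <• a ∈ ℳ (i + j)) →
        (∃! act : Omega ε 𝒜 ℳ →ₗ[K] Omega ε 𝒜 𝒜 →ₗ[K] Omega ε 𝒜 ℳ,
          IsFormProduct ε 𝒜 ℳ act) ∧
        ∀ act : Omega ε 𝒜 ℳ →ₗ[K] Omega ε 𝒜 𝒜 →ₗ[K] Omega ε 𝒜 ℳ, IsFormProduct ε 𝒜 ℳ act →
          IsGradedRightModuleAction (omegaGrading ε 𝒜 𝒜) mul (omegaOne ε 𝒜)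
            (omegaGrading ε 𝒜 ℳ) act := by
  refine ⟨existsUnique_isFormProduct smul_mem_graded, existsUnique_isFormDifferential,
    fun mul d hmul hd => ⟨isGradedAlgebraProduct_of_isFormProduct hmul,
      isFormDifferential_mem_epsDerivations hmul hd, isFormDifferential_comp_self hd, ?_⟩⟩
  intro M _ _ _ _ ℳ _ hℳ
  exact ⟨existsUnique_isFormProduct hℳ, fun act hact =>
    isGradedRightModuleAction_of_isFormProduct hℳ hmul hact⟩
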